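/- Let $\mathcal X$ be a set of datasets with a symmetric neighbor relation $\sim$, and let $(\mathcal Y,\mathcal G)$ be a measurable space whose $\sigma$-algebra is countably generated (for instance a Polish space with its Borel sets). Let $(A_n)_{n\ge1}$ be an adaptive sequence of algorithms: for every $x\in\mathcal X$, $(A_n(x))_{n\ge 1}$ is a sequence of $\mathcal Y$-valued random variables on some probability space, and $\kappa_n^x(\cdot\mid h)$, $h\in\mathcal Y^{n-1}$, is a Markov kernel that is a conditional distribution of $A_n(x)$ given $A_{1:n-1}(x)=(A_1(x),\dots,A_{n-1}(x))$. Let $\epsilon_n,\delta_n:\mathcal Y^{n-1}\to\mathbb R_{\ge0}$ be measurable. For probability measures $\mu,\nu$ on $\mathcal Y$ with densities $p,q$ with respect to a common dominating measure, let $\mathcal L_{\mu,\nu}(y)=\log\frac{p(y)}{q(y)}$, which is $+\infty$ where $q(y)=0<p(y)$. Assume that for all neighbors $x\sim x'$ and all $n\ge1$, with probability one, the history $h=A_{1:n-1}(x)$ satisfies at least one of 1. $\kappa_n^x(G\mid h)\le e^{\epsilon_n(h)}\kappa_n^{x'}(G\mid h)+\delta_n(h)$ for all $G\in\mathcal G$;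 2. $\delta_n(h)=0$ and $\int e^{\lambda\mathcal L_{\mu,\nu}}\,d\mu\le e^{\frac12\lambda(\lambda+1)\epsilon_n(h)^2}$ for all real $\lambda\ge0$, where $\mu=\kappa_n^x(\cdot\mid h)$ and $\nu=\kappa_n^{x'}(\cdot\mid h)$. Let $\epsilon>0$, $\delta'>0$, $\delta''\ge0$, and for sequences $(e_n)_{n\ge1},(d_n)_{n\ge1}$ of nonnegative reals let $$N\big((e_n),(d_n)\big)=\inf\Big\{n\ge0:\ \epsilon<\sqrt{2\log(1/\delta')\textstyle\sum_{m\le n+1}e_m^2}+\tfrac12\textstyle\sum_{m\le n+1}e_m^2\ \text{ or }\ \delta''<\textstyle\sum_{m\le n+1}d_m\Big\}\in\mathbb N\cup\{\infty\},$$ where the square root of a negative number (possible only if $\delta'>1$) is read as $0$. For $x\in\mathcal X$ let $N(x)$ be $N$ applied to the sequences $\epsilon_n(A_{1:n-1}(x))$ and $\delta_n(A_{1:n-1}(x))$, $n\ge1$. Let $A_{1:N(x)}(x)=(A_1(x),\dots,A_{N(x)}(x),\square,\square,\dots)$, padded with a terminating symbol $\square\notin\mathcal Y$ (the whole sequence if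 $N(x)=\infty$). Then $x\mapsto A_{1:N(x)}(x)$ is $(\epsilon,\delta'+\delta'')$-differentially private: for all $x\sim x'$ and all measurable $G\subseteq(\mathcal Y\cup\{\square\})^{\mathbb N}$, $$\mathbb P\big(A_{1:N(x)}(x)\in G\big)\le e^{\epsilon}\,\mathbb P\big(A_{1:N(x')}(x')\in G\big)+\delta'+\delta''.$$ -/

import Mathlib

open MeasureTheory ProbabilityTheory
open scoped ENNReal NNReal

noncomputable section

namespace FullyAdaptive

/-- The first `n` terms `(a 0, …, a (n - 1))` of a sequence of outputs. Rounds are numbered from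
`0`, so this is what is known before round number `n` (the `(n + 1)`-st round) is run. -/
def history {Y : Type*} (a : ℕ → Y) (n : ℕ) : Fin n → Y := fun i => a i

/-- The inequality `μ(G) ≤ e^ε ν(G) + δ` for all events `G`. -/
def DPBound {Y : Type*} [MeasurableSpace Y] (μ ν : Measure Y) (ε δ : ℝ≥0) : Prop :=
  ∀ G : Set Y, MeasurableSet G →
    μ G ≤ ENNReal.ofReal (Real.exp (ε : ℝ)) * ν G + (δ : ℝ≥0∞)

/-- The privacy loss `log (p(y) / q(y))`, where `p` and `q` are the densities of `μ` and `ν` with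
respect to the common dominating measure `μ + ν`. It is extended-real valued: it is `+∞` where
`p > 0` and `q = 0`. -/
def privacyLoss {Y : Type*} [MeasurableSpace Y] (μ ν : Measure Y) (y : Y) : EReal :=
  ENNReal.log (μ.rnDeriv (μ + ν) y / ν.rnDeriv (μ + ν) y)

/-- The bound `E[e^{t L}] ≤ e^{t (t + 1) ε² / 2}` for all real `t ≥ 0`, where `L` is the privacy
loss between `μ` and `ν`, evaluated at a random draw from `μ`. -/
def ZCDPBound {Y : Type*} [MeasurableSpace Y] (μ ν : Measure Y) (ε : ℝ≥0) : Prop :=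
  ∀ t : ℝ, 0 ≤ t →
    ∫⁻ y, EReal.exp ((t : EReal) * privacyLoss μ ν y) ∂μ
      ≤ ENNReal.ofReal (Real.exp (1 / 2 * t * (t + 1) * (ε : ℝ) ^ 2))

/-- An algorithm `M` assigns to each dataset `x` a random variable `M x` on a probability space
`(Ω x, P x)`. It is `(ε, δ)`-differentially private if `P(M(x) ∈ G) ≤ e^ε P(M(x') ∈ G) + δ` for
all neighbors `x, x'` and all events `G`. -/
def IsDP {X : Type*} (nbr : X → X → Prop) {Ω : X → Type*} [∀ x, MeasurableSpace (Ω x)]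
    (P : ∀ x, Measure (Ω x)) {O : Type*} [MeasurableSpace O] (M : ∀ x, Ω x → O)
    (ε δ : ℝ) : Prop :=
  ∀ x x' : X, nbr x x' → ∀ G : Set O, MeasurableSet G →
    P x (M x ⁻¹' G) ≤ ENNReal.ofReal (Real.exp ε) * P x' (M x' ⁻¹' G) + ENNReal.ofReal δ

/-- The stopping rule: the least `n ≥ 0` for which running one more round, i.e. `n + 1` rounds in
all, would exceed one of the two budgets; it is `⊤` (never stop) if there is no such `n`. Here
`e m` and `d m` are the privacy parameters of round number `m`, counted from `0`. -/
def stopRule (ε δ' δ'' : ℝ) (e d : ℕ → ℝ≥0) : ℕ∞ :=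
  sInf ((fun n : ℕ => (n : ℕ∞)) '' {n : ℕ |
    ε < √(2 * Real.log (1 / δ') * ∑ m ∈ Finset.range (n + 1), (e m : ℝ) ^ 2)
        + 1 / 2 * ∑ m ∈ Finset.range (n + 1), (e m : ℝ) ^ 2
    ∨ δ'' < ∑ m ∈ Finset.range (n + 1), (d m : ℝ)})

open Classical in
/-- The first `N` terms of a sequence of outputs, padded with the terminating symbol
`Sum.inr ()`. If `N = ⊤` this is the whole sequence. -/
def stopAt {Y : Type*} (N : ℕ∞) (a : ℕ → Y) : ℕ → Y ⊕ Unit :=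
  fun n => if (n : ℕ∞) < N then Sum.inl (a n) else Sum.inr ()

end FullyAdaptive

end

open scoped symmDiff

namespace FullyAdaptive

/-! Fix one order `t > 0`. The two privacy conditions are first merged into one statement about a
single round: up to mass `δ`, the law `μ` dominates `r ν` with `∫ r^(1+t) dν ≤ exp(t(t+1)ε²/2)`
(`approxMoment_of_roundCondition`). The proof may use the conditions in both directions, which is
where symmetry of the neighbor relation enters.

The core is a backward induction on the number of remaining rounds (`ratio_mul_value_le`), with the
likelihood ratio `w` accumulated so far as a free variable: `w · value ≤ e^ε · value' + w · (δ left)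
+ e^(-tε) w^(1+t) exp(t(t+1)/2 · (squares left))`. When the process stops, this is Markov's
inequality for the event `w > e^ε`. One more round replaces `w` by `w r`; integrating against `ν`
charges that round's `δ` and `ε²` to the budgets. The amounts left are functions of the history, so
adaptive parameters cost nothing.

At `w = 1`, with `V = sqBudget` the largest total of squares that the stopping rule allows and with
the best `t`, the last term equals `δ'` (`exp_tail_eq`). The stopping rule is the exit time from the
histories that can afford one more round (`stopRule_eq_exitTime`). Cylinder events need only
finitely many rounds, and general events are approximated by cylinders (`measure_le_of_isSetRing`).
-/

/-! ### Hyperbolic inequalities -/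

lemma mul_sinh_le_sinh_mul {k x : ℝ} (hk : 1 ≤ k) (hx : 0 ≤ x) :
    k * Real.sinh x ≤ Real.sinh (k * x) := by
  have hd : ∀ y : ℝ, HasDerivAt (fun y => Real.sinh (k * y) - k * Real.sinh y)
      (Real.cosh (k * y) * (k * 1) - k * Real.cosh y) y := fun y =>
    (((hasDerivAt_id y).const_mul k).sinh).sub ((Real.hasDerivAt_sinh y).const_mul k)
  have hm : MonotoneOn (fun y => Real.sinh (k * y) - k * Real.sinh y) (Set.Ici 0) := by
    apply monotoneOn_of_deriv_nonneg (convex_Ici 0)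
    · exact fun y _ => (hd y).continuousAt.continuousWithinAt
    · exact fun y _ => (hd y).differentiableAt.differentiableWithinAt
    · intro y hy
      rw [interior_Ici, Set.mem_Ioi] at hy
      rw [(hd y).deriv]
      have : Real.cosh y ≤ Real.cosh (k * y) := by
        rw [Real.cosh_le_cosh, abs_of_pos hy, abs_of_nonneg (by positivity)]
        nlinarith
      nlinarith
  have := hm (Set.mem_Ici.2 le_rfl) (Set.mem_Ici.2 hx) hx
  simp only [mul_zero, Real.sinh_zero, sub_zero] at this
  linarith

lemma sinh_le_mul_cosh {x : ℝ} (hx : 0 ≤ x) : Real.sinh x ≤ x * Real.cosh x := by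
  have hd : ∀ y : ℝ, HasDerivAt (fun y => y * Real.cosh y - Real.sinh y)
      (1 * Real.cosh y + y * Real.sinh y - Real.cosh y) y := fun y =>
    ((hasDerivAt_id y).mul (Real.hasDerivAt_cosh y)).sub (Real.hasDerivAt_sinh y)
  have hm : MonotoneOn (fun y => y * Real.cosh y - Real.sinh y) (Set.Ici 0) := by
    apply monotoneOn_of_deriv_nonneg (convex_Ici 0)
    · exact fun y _ => (hd y).continuousAt.continuousWithinAt
    · exact fun y _ => (hd y).differentiableAt.differentiableWithinAt
    · intro y hy
      rw [interior_Ici, Set.mem_Ioi] at hy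
      rw [(hd y).deriv]
      have := mul_nonneg hy.le (Real.sinh_nonneg_iff.2 hy.le)
      linarith
  have := hm (Set.mem_Ici.2 le_rfl) (Set.mem_Ici.2 hx) hx
  simp only [zero_mul, Real.sinh_zero, sub_zero] at this
  linarith

lemma cosh_mul_exp_antitoneOn :
    AntitoneOn (fun x : ℝ => Real.cosh x * Real.exp (-(x ^ 2 / 2))) (Set.Ici 0) := by
  have hd : ∀ y : ℝ, HasDerivAt (fun x : ℝ => Real.cosh x * Real.exp (-(x ^ 2 / 2)))
      (Real.exp (-(y ^ 2 / 2)) * (Real.sinh y - y * Real.cosh y)) y := fun y => by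
    have h1 : HasDerivAt (fun x : ℝ => -(x ^ 2 / 2)) (-y) y := by
      refine ((hasDerivAt_pow 2 y).div_const 2).neg.congr_deriv ?_
      simp
    have := (Real.hasDerivAt_cosh y).mul h1.exp
    refine this.congr_deriv ?_
    ring
  apply antitoneOn_of_deriv_nonpos (convex_Ici 0)
  · exact fun y _ => (hd y).continuousAt.continuousWithinAt
  · exact fun y _ => (hd y).differentiableAt.differentiableWithinAt
  · intro y hy
    rw [interior_Ici, Set.mem_Ioi] at hy
    rw [(hd y).deriv]
    have := sinh_le_mul_cosh hy.le
    exact mul_nonpos_of_nonneg_of_nonpos (Real.exp_pos _).le (by linarith)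

/-- The Rényi bound for randomized response. -/
lemma cosh_div_cosh_le {ε t : ℝ} (hε : 0 ≤ ε) (ht : 0 ≤ t) :
    Real.cosh ((t + 1 / 2) * ε) / Real.cosh (ε / 2)
      ≤ Real.exp (1 / 2 * t * (t + 1) * ε ^ 2) := by
  have h := cosh_mul_exp_antitoneOn (Set.mem_Ici.2 (by positivity : 0 ≤ ε / 2))
    (Set.mem_Ici.2 (by positivity : 0 ≤ (t + 1 / 2) * ε)) (by nlinarith)
  rw [div_le_iff₀ (Real.cosh_pos _)]
  simp only at h
  calc Real.cosh ((t + 1 / 2) * ε)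
      = (Real.cosh ((t + 1 / 2) * ε) * Real.exp (-(((t + 1 / 2) * ε) ^ 2 / 2)))
        * Real.exp (((t + 1 / 2) * ε) ^ 2 / 2) := by
        rw [mul_assoc, ← Real.exp_add]; simp
    _ ≤ (Real.cosh (ε / 2) * Real.exp (-((ε / 2) ^ 2 / 2)))
        * Real.exp (((t + 1 / 2) * ε) ^ 2 / 2) := by gcongr
    _ = Real.exp (1 / 2 * t * (t + 1) * ε ^ 2) * Real.cosh (ε / 2) := by
        rw [mul_assoc, ← Real.exp_add, mul_comm]
        congr 2; ring

/-! ### Sign of a function `f` with `f' = e^z g`, where `g` is its derivative in the variable `e^z`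
-/

section Calculus

variable {f g : ℝ → ℝ} (hf : ∀ z, HasDerivAt f (Real.exp z * g z) z)

include hf

lemma le_of_deriv_factor_nonneg {a b : ℝ} (hab : a ≤ b) (hg : ∀ z ∈ Set.Icc a b, 0 ≤ g z) :
    f a ≤ f b := by
  have hm : MonotoneOn f (Set.Icc a b) := by
    apply monotoneOn_of_deriv_nonneg (convex_Icc a b)
    · exact fun y _ => (hf y).continuousAt.continuousWithinAt
    · exact fun y _ => (hf y).differentiableAt.differentiableWithinAt
    · intro y hy
      rw [(hf y).deriv]
      exact mul_nonneg (Real.exp_pos _).le (hg y (interior_subset hy))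
  exact hm (Set.left_mem_Icc.2 hab) (Set.right_mem_Icc.2 hab) hab

lemma le_of_deriv_factor_nonpos {a b : ℝ} (hab : a ≤ b) (hg : ∀ z ∈ Set.Icc a b, g z ≤ 0) :
    f b ≤ f a := by
  have hm : AntitoneOn f (Set.Icc a b) := by
    apply antitoneOn_of_deriv_nonpos (convex_Icc a b)
    · exact fun y _ => (hf y).continuousAt.continuousWithinAt
    · exact fun y _ => (hf y).differentiableAt.differentiableWithinAt
    · intro y hy
      rw [(hf y).deriv]
      exact mul_nonpos_of_nonneg_of_nonpos (Real.exp_pos _).le (hg y (interior_subset hy))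
  exact hm (Set.left_mem_Icc.2 hab) (Set.right_mem_Icc.2 hab) hab

/-- As a function of `e^z`, `f` is concave, so it lies above its chord. -/
lemma nonneg_of_antitoneOn_factor {a b : ℝ} (hg : AntitoneOn g (Set.Icc a b))
    (ha : 0 ≤ f a) (hb : 0 ≤ f b) {z : ℝ} (hz : z ∈ Set.Icc a b) : 0 ≤ f z := by
  rcases le_total 0 (g z) with h | h
  · refine ha.trans (le_of_deriv_factor_nonneg hf hz.1 fun y hy => ?_)
    exact h.trans (hg ⟨hy.1, hy.2.trans hz.2⟩ hz hy.2)
  · refine hb.trans (le_of_deriv_factor_nonpos hf hz.2 fun y hy => ?_)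
    exact (hg hz ⟨hz.1.trans hy.1, hy.2⟩ hy.1).trans h

/-- In the variable `e^z`, `f` is convex up to `z₀` and concave beyond. A double zero at `a` settles
the convex piece; on the concave piece the endpoints `z₀` and `b` suffice. -/
lemma nonneg_of_tangent {a b z₀ : ℝ} (haz : a ≤ z₀)
    (hmono : MonotoneOn g (Set.Iic z₀)) (hanti : AntitoneOn g (Set.Ici z₀))
    (hga : g a = 0) (hfa : f a = 0) (hfb : f b = 0) {z : ℝ} (hz : z ≤ b) : 0 ≤ f z := by
  have mid : ∀ y, a ≤ y → y ≤ z₀ → 0 ≤ f y := fun y h1 h2 => by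
    rw [← hfa]
    refine le_of_deriv_factor_nonneg hf h1 fun u hu => ?_
    rw [← hga]
    exact hmono haz (hu.2.trans h2) hu.1
  rcases le_total z a with h | h
  · rw [← hfa]
    refine le_of_deriv_factor_nonpos hf h fun u hu => ?_
    rw [← hga]
    exact hmono (hu.2.trans haz) haz hu.2
  rcases le_total z z₀ with h' | h'
  · exact mid z h h'
  · exact nonneg_of_antitoneOn_factor hf (hanti.mono Set.Icc_subset_Ici_self) (mid z₀ haz le_rfl)
      hfb.ge ⟨h', hz⟩

end Calculus

/-! ### Pointwise upper bounds for `e^((1+t)z)` -/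

/-- Intercept of the chord of `x ↦ x ^ (1 + t)` through the points `e^{-ε}` and `e^ε`. -/
noncomputable def chordIntercept (ε t : ℝ) : ℝ :=
  -(Real.sinh (t * ε) / Real.sinh ε)

/-- Slope of the chord of `x ↦ x ^ (1 + t)` through the points `e^{-ε}` and `e^ε`. -/
noncomputable def chordSlope (ε t : ℝ) : ℝ :=
  Real.sinh ((1 + t) * ε) / Real.sinh ε

lemma exp_one_add_mul (ε t : ℝ) :
    Real.exp ((1 + t) * ε) = Real.exp ε * Real.exp (t * ε) := by
  rw [← Real.exp_add]; congr 1; ring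

lemma sinh_one_add_mul (ε t : ℝ) : Real.sinh ((1 + t) * ε) =
    (Real.exp ε * Real.exp (t * ε) - (Real.exp ε)⁻¹ * (Real.exp (t * ε))⁻¹) / 2 := by
  rw [Real.sinh_eq, Real.exp_neg, exp_one_add_mul, mul_inv]

lemma chord_right {ε : ℝ} (hε : 0 < ε) (t : ℝ) :
    chordIntercept ε t + chordSlope ε t * Real.exp ε = Real.exp ((1 + t) * ε) := by
  have hs : Real.sinh ε ≠ 0 := (Real.sinh_pos_iff.2 hε).ne'
  rw [chordIntercept, chordSlope, ← mul_left_inj' hs, add_mul, mul_right_comm, neg_mul,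
    div_mul_cancel₀ _ hs, div_mul_cancel₀ _ hs, sinh_one_add_mul, exp_one_add_mul,
    Real.sinh_eq, Real.sinh_eq, Real.exp_neg, Real.exp_neg]
  field_simp
  ring

lemma chord_left {ε : ℝ} (hε : 0 < ε) (t : ℝ) :
    chordIntercept ε t + chordSlope ε t * Real.exp (-ε) = Real.exp ((1 + t) * -ε) := by
  have hs : Real.sinh ε ≠ 0 := (Real.sinh_pos_iff.2 hε).ne'
  rw [chordIntercept, chordSlope, ← mul_left_inj' hs, add_mul, mul_right_comm, neg_mul,
    div_mul_cancel₀ _ hs, div_mul_cancel₀ _ hs, sinh_one_add_mul, mul_neg,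
    Real.exp_neg ((1 + t) * ε), exp_one_add_mul,
    Real.sinh_eq, Real.sinh_eq, Real.exp_neg, Real.exp_neg]
  field_simp
  ring

lemma chordIntercept_nonpos {ε t : ℝ} (hε : 0 < ε) (ht : 0 ≤ t) : chordIntercept ε t ≤ 0 := by
  have h1 := Real.sinh_pos_iff.2 hε
  have h2 := Real.sinh_nonneg_iff.2 (mul_nonneg ht hε.le)
  rw [chordIntercept, neg_nonpos]
  positivity

/-- The chord at `x = 1` has height `cosh((t+1/2)ε) / cosh(ε/2)`, the moment for randomized
response, which is the extremal case of pure privacy. -/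
lemma chord_sum_le {ε t : ℝ} (hε : 0 < ε) (ht : 0 ≤ t) :
    chordIntercept ε t + chordSlope ε t ≤ Real.exp (1 / 2 * t * (t + 1) * ε ^ 2) := by
  refine le_of_eq_of_le ?_ (cosh_div_cosh_le hε.le ht)
  have hs : Real.sinh ε ≠ 0 := (Real.sinh_pos_iff.2 hε).ne'
  have hs2 : Real.sinh (ε / 2) ≠ 0 := (Real.sinh_pos_iff.2 (by positivity)).ne'
  have hc : Real.cosh (ε / 2) ≠ 0 := (Real.cosh_pos _).ne'
  have e0 : Real.sinh ε = 2 * Real.sinh (ε / 2) * Real.cosh (ε / 2) := by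
    rw [← Real.sinh_two_mul]; congr 1; ring
  have e1 : Real.sinh ((1 + t) * ε) = Real.sinh ((t + 1 / 2) * ε + ε / 2) := by congr 1; ring
  have e2 : Real.sinh (t * ε) = Real.sinh ((t + 1 / 2) * ε - ε / 2) := by congr 1; ring
  rw [chordIntercept, chordSlope, e1, e2, Real.sinh_add, Real.sinh_sub, e0]
  field_simp
  ring

/-- A line above `e^{(1 + t) z}`, as a function of `e^z`, on `[-ε, ε]`. -/
lemma exists_line_bound {ε t : ℝ} (hε : 0 ≤ ε) (ht : 0 ≤ t) :
    ∃ α β : ℝ, α ≤ 0 ∧ α + β ≤ Real.exp (1 / 2 * t * (t + 1) * ε ^ 2) ∧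
      ∀ z ∈ Set.Icc (-ε) ε, Real.exp ((1 + t) * z) ≤ α + β * Real.exp z := by
  rcases hε.eq_or_lt with rfl | hε
  · refine ⟨0, 1, le_rfl, by simp, fun z hz => ?_⟩
    have : z = 0 := le_antisymm hz.2 (by simpa using hz.1)
    simp [this]
  refine ⟨chordIntercept ε t, chordSlope ε t, chordIntercept_nonpos hε ht, chord_sum_le hε ht,
    fun z hz => ?_⟩
  have hf : ∀ z, HasDerivAt
      (fun z => chordIntercept ε t + chordSlope ε t * Real.exp z - Real.exp ((1 + t) * z))
      (Real.exp z * (chordSlope ε t - (1 + t) * Real.exp (t * z))) z := fun z => by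
    refine ((((Real.hasDerivAt_exp z).const_mul (chordSlope ε t)).const_add
      (chordIntercept ε t)).sub (((hasDerivAt_id z).const_mul (1 + t)).exp)).congr_deriv ?_
    rw [id, exp_one_add_mul]
    ring
  have := nonneg_of_antitoneOn_factor hf (a := -ε) (b := ε) ?_ ?_ ?_ hz
  · linarith
  · intro x _ y _ hxy
    have : Real.exp (t * x) ≤ Real.exp (t * y) := Real.exp_le_exp.2 (by gcongr)
    have : (1 + t) * Real.exp (t * x) ≤ (1 + t) * Real.exp (t * y) := by gcongr
    simp only
    linarith
  · rw [chord_left hε]; simp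
  · rw [chord_right hε]; simp

lemma tangent_num_pos {ε t : ℝ} (hε : 0 < ε) (ht : 0 < t) :
    0 < chordSlope ε t - (1 + t) * Real.exp (-(t * ε)) := by
  have h := mul_sinh_le_sinh_mul (k := 1 + t) (by linarith) hε.le
  have hs := Real.sinh_pos_iff.2 hε
  have he : Real.exp (-(t * ε)) < 1 := Real.exp_lt_one_iff.2 (by nlinarith)
  rw [chordSlope, sub_pos, lt_div_iff₀ hs]
  refine lt_of_lt_of_le ?_ h
  have : 0 < (1 + t) * Real.sinh ε := by positivity
  nlinarith

/-- Times `sinh ε`, the difference of the sides is `(1 + e^ε)(t sinh((t+1)ε) - (t+1) sinh(tε))`. It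
serves to give `γ ≤ 1` in `exists_mixed_bound`. -/
lemma tangent_num_le {ε t : ℝ} (hε : 0 < ε) (ht : 0 < t) :
    chordSlope ε t - (1 + t) * Real.exp (-(t * ε))
      ≤ chordIntercept ε t + t * Real.exp ((t + 1) * ε) := by
  have h := mul_sinh_le_sinh_mul (k := (t + 1) / t) (x := t * ε)
    (by rw [le_div_iff₀ ht]; linarith) (by positivity)
  have e : (t + 1) / t * (t * ε) = (t + 1) * ε := by field_simp
  rw [e, div_mul_eq_mul_div, div_le_iff₀ ht] at h
  have hs := Real.sinh_pos_iff.2 hε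
  rw [chordSlope, chordIntercept, ← sub_nonneg]
  have key : 0 ≤ Real.sinh ((t + 1) * ε) * t - (t + 1) * Real.sinh (t * ε) := by linarith
  refine nonneg_of_mul_nonneg_left (b := Real.sinh ε) ?_ hs
  refine le_of_le_of_eq (mul_nonneg (by positivity : 0 ≤ 1 + Real.exp ε) key) ?_
  rw [add_comm t 1, sub_mul _ _ (Real.sinh ε), add_mul (-(_ / _)), sub_mul (_ / _), neg_mul,
    div_mul_cancel₀ _ hs.ne', div_mul_cancel₀ _ hs.ne', sinh_one_add_mul, exp_one_add_mul,
    Real.sinh_eq, Real.sinh_eq, Real.exp_neg, Real.exp_neg]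
  field_simp
  ring

/-- Times `sinh ε`, the difference is `e^((t+1)ε)(sinh((2t+1)ε) - (2t+1) sinh ε)`. It serves to
place the inflection `z₀` to the right of `-ε`. -/
lemma tangent_den_le {ε t : ℝ} (hε : 0 < ε) (ht : 0 < t) :
    chordIntercept ε t + t * Real.exp ((t + 1) * ε)
      ≤ (chordSlope ε t - (1 + t) * Real.exp (-(t * ε))) * Real.exp ((2 * t + 1) * ε) := by
  have h := mul_sinh_le_sinh_mul (k := 2 * t + 1) (by linarith) hε.le
  have hs := Real.sinh_pos_iff.2 hε
  rw [chordSlope, chordIntercept, ← sub_nonneg]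
  have key : 0 ≤ Real.exp ((t + 1) * ε) *
      (Real.sinh ((2 * t + 1) * ε) - (2 * t + 1) * Real.sinh ε) :=
    mul_nonneg (Real.exp_pos _).le (by linarith)
  refine nonneg_of_mul_nonneg_left (b := Real.sinh ε) ?_ hs
  have e1 : Real.exp ((2 * t + 1) * ε)
      = Real.exp (t * ε) * Real.exp (t * ε) * Real.exp ε := by
    rw [← Real.exp_add, ← Real.exp_add]; congr 1; ring
  refine le_of_le_of_eq key ?_
  rw [add_comm t 1, sub_mul, mul_right_comm, add_mul (-(_ / _)), sub_mul (_ / _), neg_mul,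
    div_mul_cancel₀ _ hs.ne', div_mul_cancel₀ _ hs.ne', sinh_one_add_mul, exp_one_add_mul,
    Real.sinh_eq, Real.sinh_eq, Real.sinh_eq, Real.exp_neg, Real.exp_neg, Real.exp_neg, e1]
  field_simp
  ring

/-- An upper bound for `e^{(1 + t) z}` on `(-∞, ε]` by a combination of `1`, `e^z`
and `e^{-t z}`. -/
lemma exists_mixed_bound {ε t : ℝ} (hε : 0 ≤ ε) (ht : 0 < t) :
    ∃ α β γ : ℝ, 0 ≤ γ ∧ α + β ≤ (1 - γ) * Real.exp (1 / 2 * t * (t + 1) * ε ^ 2) ∧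
      ∀ z ≤ ε, Real.exp ((1 + t) * z) ≤ α + β * Real.exp z + γ * Real.exp (-(t * z)) := by
  rcases hε.eq_or_lt with rfl | hε
  · refine ⟨0, 1, 0, le_rfl, by simp, fun z hz => ?_⟩
    have : Real.exp ((1 + t) * z) ≤ Real.exp z := Real.exp_le_exp.2 (by nlinarith)
    simpa using this
  set u := chordSlope ε t - (1 + t) * Real.exp (-(t * ε)) with hu
  set v := chordIntercept ε t + t * Real.exp ((t + 1) * ε) with hv
  have hu0 : 0 < u := tangent_num_pos hε ht
  have huv : u ≤ v := tangent_num_le hε ht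
  have hvu : v ≤ u * Real.exp ((2 * t + 1) * ε) := tangent_den_le hε ht
  have hv0 : 0 < v := hu0.trans_le huv
  set γ := u / v with hγ
  have hγ0 : 0 < γ := div_pos hu0 hv0
  have hγ1 : γ ≤ 1 := (div_le_one hv0).2 huv
  have hγE : 1 ≤ γ * Real.exp ((2 * t + 1) * ε) := by
    rw [hγ, div_mul_eq_mul_div, one_le_div hv0]; exact hvu
  have hγv : γ * v = u := div_mul_cancel₀ _ hv0.ne'
  set A := chordIntercept ε t
  set B := chordSlope ε t
  -- The gap in the bound is `(A + B e^z - e^((1+t)z)) - γ (B + A e^z - e^(-tz))`. Both brackets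
  -- vanish at `±ε`, the second being `e^z` times the first at `-z`. The choice `γ = u / v` makes
  -- the zero at `-ε` double, so the bound persists for `z < -ε`.
  refine ⟨A - γ * B, B - γ * A, γ, hγ0.le, ?_, fun z hz => ?_⟩
  · have := chord_sum_le hε ht.le
    have := mul_le_mul_of_nonneg_left this (sub_nonneg.2 hγ1)
    linarith
  set g : ℝ → ℝ := fun z =>
    (B - γ * A) - γ * t * Real.exp (-((t + 1) * z)) - (1 + t) * Real.exp (t * z) with hg
  have hf : ∀ z, HasDerivAt (fun z => (A - γ * B) + (B - γ * A) * Real.exp z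
      + γ * Real.exp (-(t * z)) - Real.exp ((1 + t) * z)) (Real.exp z * g z) z := fun z => by
    refine (((((Real.hasDerivAt_exp z).const_mul (B - γ * A)).const_add (A - γ * B)).add
      ((((hasDerivAt_id z).const_mul t).neg.exp).const_mul γ)).sub
      (((hasDerivAt_id z).const_mul (1 + t)).exp)).congr_deriv ?_
    simp only [id, Pi.neg_apply, hg]
    rw [add_comm t 1, Real.exp_neg, Real.exp_neg, exp_one_add_mul]
    field_simp
    ring
  set z₀ := Real.log γ / (2 * t + 1) with hz₀
  have hz₀γ : ∀ z, γ * Real.exp (-((t + 1) * z)) =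
      Real.exp (t * z) * Real.exp ((2 * t + 1) * (z₀ - z)) := fun z => by
    conv_lhs => rw [← Real.exp_log hγ0]
    rw [← Real.exp_add, ← Real.exp_add]
    congr 1
    rw [hz₀]; field_simp; ring
  have hgd : ∀ z, HasDerivAt g
      (t * (t + 1) * Real.exp (t * z) * (Real.exp ((2 * t + 1) * (z₀ - z)) - 1)) z := fun z => by
    refine ((((((hasDerivAt_id z).const_mul (t + 1)).neg.exp).const_mul (γ * t)).const_sub
      (B - γ * A)).sub ((((hasDerivAt_id z).const_mul t).exp).const_mul (1 + t))).congr_deriv ?_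
    have := hz₀γ z
    simp only [id, Pi.neg_apply]
    linear_combination (t * (t + 1)) * this
  have hmono : MonotoneOn g (Set.Iic z₀) := by
    apply monotoneOn_of_deriv_nonneg (convex_Iic _)
    · exact fun y _ => (hgd y).continuousAt.continuousWithinAt
    · exact fun y _ => (hgd y).differentiableAt.differentiableWithinAt
    · intro y hy
      rw [interior_Iic, Set.mem_Iio] at hy
      rw [(hgd y).deriv]
      have : 1 ≤ Real.exp ((2 * t + 1) * (z₀ - y)) :=
        Real.one_le_exp (mul_nonneg (by linarith) (by linarith))
      exact mul_nonneg (by positivity) (by linarith)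
  have hanti : AntitoneOn g (Set.Ici z₀) := by
    apply antitoneOn_of_deriv_nonpos (convex_Ici _)
    · exact fun y _ => (hgd y).continuousAt.continuousWithinAt
    · exact fun y _ => (hgd y).differentiableAt.differentiableWithinAt
    · intro y hy
      rw [interior_Ici, Set.mem_Ioi] at hy
      rw [(hgd y).deriv]
      have : Real.exp ((2 * t + 1) * (z₀ - y)) ≤ 1 :=
        Real.exp_le_one_iff.2 (mul_nonpos_of_nonneg_of_nonpos (by linarith) (by linarith))
      exact mul_nonpos_of_nonneg_of_nonpos (by positivity) (by linarith)
  have hR := chord_right hε t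
  have hL := chord_left hε t
  have hE : Real.exp ε * Real.exp (-ε) = 1 := by rw [← Real.exp_add]; simp
  have hR' : A * Real.exp (-ε) + B = Real.exp (t * ε) := by
    have : Real.exp (t * ε) = Real.exp ((1 + t) * ε) * Real.exp (-ε) := by
      rw [← Real.exp_add]; congr 1; ring
    rw [this, ← hR]; linear_combination (-B) * hE
  have hL' : A * Real.exp ε + B = Real.exp (-(t * ε)) := by
    have : Real.exp (-(t * ε)) = Real.exp ((1 + t) * -ε) * Real.exp ε := by
      rw [← Real.exp_add]; congr 1; ring
    rw [this, ← hL]; linear_combination (-B) * hE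
  have := nonneg_of_tangent hf (a := -ε) (b := ε) (z₀ := z₀) ?_ hmono hanti ?_ ?_ ?_ hz
  · linarith
  · rw [hz₀, le_div_iff₀ (by linarith)]
    have := Real.log_le_log one_pos hγE
    rw [Real.log_one, Real.log_mul hγ0.ne' (Real.exp_pos _).ne', Real.log_exp] at this
    linarith
  · have e1 : Real.exp (-((t + 1) * -ε)) = Real.exp ((t + 1) * ε) := by congr 1; ring
    have e2 : Real.exp (t * -ε) = Real.exp (-(t * ε)) := by congr 1; ring
    simp only [hg, e1, e2]
    rw [hu, hv] at hγv
    linear_combination -hγv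
  · have e2 : Real.exp (-(t * -ε)) = Real.exp (t * ε) := by congr 1; ring
    rw [e2]
    linear_combination hL - γ * hR'
  · linear_combination hR - γ * hL'

/-! ### A single round: densities and moments -/

section OneRound

variable {Y : Type*} [MeasurableSpace Y]

/-- The density of `μ` with respect to `μ + ν`. -/
noncomputable def leftDensity (μ ν : Measure Y) : Y → ℝ≥0∞ := μ.rnDeriv (μ + ν)

lemma measurable_leftDensity (μ ν : Measure Y) : Measurable (leftDensity μ ν) :=
  Measure.measurable_rnDeriv _ _

section Densities

lemma leftDensity_ne_top (μ ν : Measure Y) [SigmaFinite μ] :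
    ∀ᵐ y ∂(μ + ν), leftDensity μ ν y ≠ ∞ := Measure.rnDeriv_ne_top _ _

lemma leftDensity_swap_ne_top (μ ν : Measure Y) [SigmaFinite ν] :
    ∀ᵐ y ∂(μ + ν), leftDensity ν μ y ≠ ∞ := by
  rw [add_comm]; exact leftDensity_ne_top ν μ

variable (μ ν : Measure Y) [IsFiniteMeasure μ] [IsFiniteMeasure ν]

lemma withDensity_leftDensity : (μ + ν).withDensity (leftDensity μ ν) = μ :=
  Measure.withDensity_rnDeriv_eq _ _ (Measure.AbsolutelyContinuous.rfl.add_right ν)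

lemma withDensity_leftDensity_swap : (μ + ν).withDensity (leftDensity ν μ) = ν := by
  rw [add_comm]; exact withDensity_leftDensity ν μ

lemma setLIntegral_leftDensity {s : Set Y} (hs : MeasurableSet s) :
    ∫⁻ y in s, leftDensity μ ν y ∂(μ + ν) = μ s := by
  rw [← withDensity_apply _ hs, withDensity_leftDensity]

lemma setLIntegral_leftDensity_swap {s : Set Y} (hs : MeasurableSet s) :
    ∫⁻ y in s, leftDensity ν μ y ∂(μ + ν) = ν s := by
  rw [← withDensity_apply _ hs, withDensity_leftDensity_swap]

lemma lintegral_leftDensity : ∫⁻ y, leftDensity μ ν y ∂(μ + ν) = μ Set.univ := by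
  rw [← setLIntegral_leftDensity μ ν MeasurableSet.univ, setLIntegral_univ]

lemma lintegral_leftDensity_swap : ∫⁻ y, leftDensity ν μ y ∂(μ + ν) = ν Set.univ := by
  rw [← setLIntegral_leftDensity_swap μ ν MeasurableSet.univ, setLIntegral_univ]

/-- The worst event is `{p > e^ε q}`. The integral form replaces the quantifier over events, which
makes the condition measurable in a parameter. -/
lemma dpBound_iff (ε δ : ℝ≥0) :
    DPBound μ ν ε δ ↔
      ∫⁻ y, (leftDensity μ ν y - ENNReal.ofReal (Real.exp (ε : ℝ)) * leftDensity ν μ y) ∂(μ + ν)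
        ≤ δ := by
  set E := ENNReal.ofReal (Real.exp (ε : ℝ))
  have hP := measurable_leftDensity μ ν
  have hQ := measurable_leftDensity ν μ
  constructor
  · intro h
    have hG : MeasurableSet {y | E * leftDensity ν μ y < leftDensity μ ν y} :=
      measurableSet_lt (hQ.const_mul _) hP
    set G := {y | E * leftDensity ν μ y < leftDensity μ ν y}
    have e : ∫⁻ y, (leftDensity μ ν y - E * leftDensity ν μ y) ∂(μ + ν)
        = ∫⁻ y in G, (leftDensity μ ν y - E * leftDensity ν μ y) ∂(μ + ν) := by
      rw [← lintegral_indicator hG]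
      refine lintegral_congr fun y => ?_
      by_cases hy : y ∈ G
      · rw [Set.indicator_of_mem hy]
      · rw [Set.indicator_of_notMem hy, tsub_eq_zero_iff_le]
        exact not_lt.1 hy
    have hint : ∫⁻ y in G, E * leftDensity ν μ y ∂(μ + ν) = E * ν G := by
      rw [lintegral_const_mul _ hQ, setLIntegral_leftDensity_swap _ _ hG]
    rw [e, lintegral_sub (hQ.const_mul _), hint, setLIntegral_leftDensity _ _ hG,
      tsub_le_iff_left]
    · exact h G hG
    · rw [hint]; exact ENNReal.mul_ne_top ENNReal.ofReal_ne_top (measure_ne_top _ _)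
    · exact (ae_restrict_iff' hG).2 (.of_forall fun y hy => le_of_lt hy)
  · intro h G hG
    calc μ G = ∫⁻ y in G, leftDensity μ ν y ∂(μ + ν) := (setLIntegral_leftDensity _ _ hG).symm
      _ ≤ ∫⁻ y in G, (E * leftDensity ν μ y
            + (leftDensity μ ν y - E * leftDensity ν μ y)) ∂(μ + ν) :=
          lintegral_mono fun y => le_add_tsub
      _ = E * ν G + ∫⁻ y in G, (leftDensity μ ν y - E * leftDensity ν μ y) ∂(μ + ν) := by
          rw [lintegral_add_left (hQ.const_mul _), lintegral_const_mul _ hQ,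
            setLIntegral_leftDensity_swap _ _ hG]
      _ ≤ E * ν G + δ := by
          gcongr
          exact (setLIntegral_le_lintegral _ _).trans h

end Densities

/-- The bound on the exponential moment of order `t` of the privacy loss. -/
def RenyiBound (μ ν : Measure Y) (t : ℝ) (ε : ℝ≥0) : Prop :=
  ∫⁻ y, (leftDensity μ ν y / leftDensity ν μ y) ^ t ∂μ
    ≤ ENNReal.ofReal (Real.exp (1 / 2 * t * (t + 1) * (ε : ℝ) ^ 2))

lemma ZCDPBound.renyiBound {μ ν : Measure Y} {ε : ℝ≥0} (h : ZCDPBound μ ν ε) {t : ℝ}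
    (ht : 0 ≤ t) : RenyiBound μ ν t ε := by
  refine le_of_eq_of_le (lintegral_congr fun y => ?_) (h t ht)
  rw [ENNReal.rpow_eq_exp_mul_log, privacyLoss, leftDensity, leftDensity, add_comm ν μ]

/-- One of the two privacy conditions, the second one only for a single moment. -/
def RoundCondition (μ ν : Measure Y) (t : ℝ) (ε δ : ℝ≥0) : Prop :=
  DPBound μ ν ε δ ∨ (δ = 0 ∧ RenyiBound μ ν t ε)

/-- Up to mass `δ`, the measure `μ` dominates a measure whose density with respect to `ν`
has a `(1 + t)`-th moment bounded by `C`. -/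
def ApproxMoment (μ ν : Measure Y) (t : ℝ) (δ C : ℝ≥0∞) : Prop :=
  ∃ r : Y → ℝ≥0∞, Measurable r ∧ ν.withDensity r ≤ μ ∧
    μ Set.univ ≤ ν.withDensity r Set.univ + δ ∧ ∫⁻ y, r y ^ (1 + t) ∂ν ≤ C

lemma lintegral_le_of_le_of_univ_le {μ μ' : Measure Y} [IsFiniteMeasure μ] {δ : ℝ≥0∞}
    (hle : μ' ≤ μ) (huniv : μ Set.univ ≤ μ' Set.univ + δ) {F : Y → ℝ≥0∞} (hF : ∀ y, F y ≤ 1) :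
    ∫⁻ y, F y ∂μ ≤ ∫⁻ y, F y ∂μ' + δ := by
  have : IsFiniteMeasure μ' := isFiniteMeasure_of_le μ hle
  calc ∫⁻ y, F y ∂μ = ∫⁻ y, F y ∂(μ - μ' + μ') := by rw [Measure.sub_add_cancel_of_le hle]
    _ = ∫⁻ y, F y ∂μ' + ∫⁻ y, F y ∂(μ - μ') := by rw [lintegral_add_measure, add_comm]
    _ ≤ ∫⁻ y, F y ∂μ' + ∫⁻ _, 1 ∂(μ - μ') := by gcongr; exact hF _
    _ ≤ ∫⁻ y, F y ∂μ' + δ := by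
        gcongr
        rw [lintegral_one, Measure.sub_apply MeasurableSet.univ hle, tsub_le_iff_left]
        exact huniv

section OneStep

variable {μ ν : Measure Y} [IsProbabilityMeasure μ] [IsProbabilityMeasure ν]

lemma withDensity_ratio
    (h : ∀ᵐ y ∂(μ + ν), leftDensity ν μ y = 0 → leftDensity μ ν y = 0) :
    ν.withDensity (fun y => leftDensity μ ν y / leftDensity ν μ y) = μ := by
  have hP := measurable_leftDensity μ ν
  have hQ := measurable_leftDensity ν μ
  have hr : Measurable fun y => leftDensity μ ν y / leftDensity ν μ y := hP.div hQ
  have h1 := withDensity_mul (μ + ν) hQ hr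
  rw [withDensity_leftDensity_swap] at h1
  have h2 := withDensity_leftDensity μ ν
  rw [← h1]
  refine Eq.trans (withDensity_congr_ae ?_) h2
  filter_upwards [h, leftDensity_swap_ne_top μ ν] with y hy hy'
  rw [Pi.mul_apply]
  by_cases h0 : leftDensity ν μ y = 0
  · rw [h0, hy h0]; simp
  · exact ENNReal.mul_div_cancel h0 hy'

/-- A finite moment of order `t > 0` forces `μ ≪ ν`, since the ratio is `∞` where `q = 0 < p`. Then
`r = dμ/dν` works because `∫ r^t dμ = ∫ r^(1+t) dν`. -/
lemma approxMoment_of_renyiBound {t : ℝ} (ht : 0 < t) {ε : ℝ≥0} (h : RenyiBound μ ν t ε) :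
    ApproxMoment μ ν t 0 (ENNReal.ofReal (Real.exp (1 / 2 * t * (t + 1) * (ε : ℝ) ^ 2))) := by
  have hP := measurable_leftDensity μ ν
  have hQ := measurable_leftDensity ν μ
  have hfin : ∀ᵐ y ∂μ, (leftDensity μ ν y / leftDensity ν μ y) ^ t < ∞ :=
    ae_lt_top ((hP.div hQ).pow_const t) (h.trans_lt ENNReal.ofReal_lt_top).ne
  have hac : ∀ᵐ y ∂(μ + ν), leftDensity ν μ y = 0 → leftDensity μ ν y = 0 := by
    have hfin' : ∀ᵐ y ∂((μ + ν).withDensity (leftDensity μ ν)),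
        (leftDensity μ ν y / leftDensity ν μ y) ^ t < ∞ := by
      rwa [withDensity_leftDensity]
    rw [ae_withDensity_iff hP] at hfin'
    filter_upwards [hfin'] with y hy h0
    by_contra hne
    have := hy hne
    rw [h0, ENNReal.div_zero hne, ENNReal.top_rpow_of_pos ht] at this
    exact this.ne rfl
  have hw := withDensity_ratio hac
  have hr : Measurable fun y => leftDensity μ ν y / leftDensity ν μ y := hP.div hQ
  refine ⟨_, hr, hw.le, by rw [hw]; simp, le_of_eq_of_le ?_ h⟩
  have := lintegral_withDensity_eq_lintegral_mul ν hr (hr.pow_const t)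
  rw [hw] at this
  rw [this]
  refine lintegral_congr fun y => ?_
  rw [Pi.mul_apply, ENNReal.rpow_add_of_nonneg _ _ zero_le_one ht.le, ENNReal.rpow_one]

/-- Here `r = dμ/dν` is bounded by `e^ε` but has no pointwise lower bound; the reverse moment `∫
r^(-t) dν ≤ D` replaces it. Integrating the bound of `exists_mixed_bound` at `z = log r` gives at
most `α + β + γ D ≤ D`. -/
lemma approxMoment_of_mixed {t : ℝ} (ht : 0 < t) {ε : ℝ≥0} (hμν : DPBound μ ν ε 0)
    (hνμ : RenyiBound ν μ t ε) :
    ApproxMoment μ ν t 0 (ENNReal.ofReal (Real.exp (1 / 2 * t * (t + 1) * (ε : ℝ) ^ 2))) := by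
  have hP := measurable_leftDensity μ ν
  have hQ := measurable_leftDensity ν μ
  set D := Real.exp (1 / 2 * t * (t + 1) * (ε : ℝ) ^ 2) with hD
  have hle : ∀ᵐ y ∂(μ + ν), leftDensity μ ν y
      ≤ ENNReal.ofReal (Real.exp (ε : ℝ)) * leftDensity ν μ y := by
    have h0 := (dpBound_iff μ ν ε 0).1 hμν
    have hm : Measurable fun y => leftDensity μ ν y
        - ENNReal.ofReal (Real.exp (ε : ℝ)) * leftDensity ν μ y := hP.sub (hQ.const_mul _)
    rw [ENNReal.coe_zero, nonpos_iff_eq_zero, lintegral_eq_zero_iff hm] at h0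
    filter_upwards [h0] with y hy
    exact tsub_eq_zero_iff_le.1 hy
  have hac : ∀ᵐ y ∂(μ + ν), leftDensity ν μ y = 0 → leftDensity μ ν y = 0 := by
    filter_upwards [hle] with y hy h0
    simpa [h0] using hy
  have hw := withDensity_ratio hac
  set r : Y → ℝ≥0∞ := fun y => leftDensity μ ν y / leftDensity ν μ y with hrdef
  have hr : Measurable r := hP.div hQ
  have hrt : Measurable fun y => (r y)⁻¹ ^ t := hr.inv.pow_const t
  refine ⟨r, hr, hw.le, by rw [hw]; simp, ?_⟩
  have hνρ : ν ≪ μ + ν := Measure.AbsolutelyContinuous.rfl.add_right' _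
  have hQpos : ∀ᵐ y ∂ν, leftDensity ν μ y ≠ 0 := by
    have : ∀ᵐ y ∂((μ + ν).withDensity (leftDensity ν μ)), leftDensity ν μ y ≠ 0 := by
      rw [ae_withDensity_iff hQ]; exact .of_forall fun _ => id
    rwa [withDensity_leftDensity_swap] at this
  have hinv : ∀ᵐ y ∂ν, leftDensity ν μ y / leftDensity μ ν y = (r y)⁻¹ := by
    filter_upwards [hQpos, hνρ (leftDensity_swap_ne_top μ ν)] with y h1 h2
    rw [hrdef, ENNReal.inv_div (Or.inl h2) (Or.inl h1)]
  have hmom : ∫⁻ y, (r y)⁻¹ ^ t ∂ν ≤ ENNReal.ofReal D := by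
    refine le_of_eq_of_le (lintegral_congr_ae ?_) hνμ
    filter_upwards [hinv] with y hy
    rw [hy]
  have hrE : ∀ᵐ y ∂ν, r y ≤ ENNReal.ofReal (Real.exp (ε : ℝ)) := by
    filter_upwards [hQpos, hνρ (leftDensity_swap_ne_top μ ν), hνρ hle] with y h1 h2 h3
    exact ENNReal.div_le_of_le_mul h3
  have hrpos : ∀ᵐ y ∂ν, r y ≠ 0 := by
    have := ae_lt_top hrt (hmom.trans_lt ENNReal.ofReal_lt_top).ne
    filter_upwards [this] with y hy h0
    rw [h0, ENNReal.inv_zero, ENNReal.top_rpow_of_pos ht] at hy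
    exact hy.ne rfl
  have hrint : ∫⁻ y, r y ∂ν = 1 := by
    have := congrArg (fun m => m Set.univ) hw
    simpa [withDensity_apply _ MeasurableSet.univ] using this
  obtain ⟨α, β, γ, hγ, hsum, hbd⟩ := exists_mixed_bound (ε := ε) ε.2 ht
  have hx : ∀ᵐ y ∂ν, 0 < (r y).toReal ∧ (r y).toReal ≤ Real.exp ε ∧ r y ≠ ∞ := by
    filter_upwards [hrE, hrpos] with y h1 h2
    have h3 : r y ≠ ∞ := (h1.trans_lt ENNReal.ofReal_lt_top).ne
    exact ⟨ENNReal.toReal_pos h2 h3, ENNReal.toReal_le_of_le_ofReal (Real.exp_pos _).le h1, h3⟩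
  have hpt : ∀ᵐ y ∂ν, (r y).toReal ^ (1 + t)
      ≤ α + β * (r y).toReal + γ * ((r y)⁻¹ ^ t).toReal := by
    filter_upwards [hx] with y ⟨h1, h2, h3⟩
    have := hbd (Real.log (r y).toReal) ((Real.log_le_iff_le_exp h1).2 h2)
    rw [Real.exp_log h1] at this
    rw [← ENNReal.toReal_rpow, ENNReal.toReal_inv, Real.inv_rpow h1.le, ← Real.rpow_neg h1.le,
      Real.rpow_def_of_pos h1, Real.rpow_def_of_pos h1]
    convert this using 2
    · ring
    · congr 2; ring
  have i1 : Integrable (fun y => (r y).toReal) ν :=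
    integrable_toReal_of_lintegral_ne_top hr.aemeasurable (by rw [hrint]; simp)
  have i2 : Integrable (fun y => ((r y)⁻¹ ^ t).toReal) ν :=
    integrable_toReal_of_lintegral_ne_top hrt.aemeasurable
      (hmom.trans_lt ENNReal.ofReal_lt_top).ne
  have i3 : Integrable (fun y => α + β * (r y).toReal + γ * ((r y)⁻¹ ^ t).toReal) ν :=
    ((integrable_const α).add (i1.const_mul β)).add (i2.const_mul γ)
  have v1 : ∫ y, (r y).toReal ∂ν = 1 := by
    rw [integral_toReal hr.aemeasurable, hrint, ENNReal.toReal_one]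
    filter_upwards [hx] with y hy using hy.2.2.lt_top
  have v2 : ∫ y, ((r y)⁻¹ ^ t).toReal ∂ν ≤ D := by
    rw [integral_toReal hrt.aemeasurable
      (ae_lt_top hrt (hmom.trans_lt ENNReal.ofReal_lt_top).ne)]
    exact ENNReal.toReal_le_of_le_ofReal (Real.exp_pos _).le hmom
  calc ∫⁻ y, r y ^ (1 + t) ∂ν
      = ∫⁻ y, ENNReal.ofReal ((r y).toReal ^ (1 + t)) ∂ν := by
        refine lintegral_congr_ae ?_
        filter_upwards [hx] with y hy
        rw [← ENNReal.ofReal_rpow_of_pos hy.1, ENNReal.ofReal_toReal hy.2.2]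
    _ ≤ ∫⁻ y, ENNReal.ofReal (α + β * (r y).toReal + γ * ((r y)⁻¹ ^ t).toReal) ∂ν := by
        refine lintegral_mono_ae ?_
        filter_upwards [hpt] with y hy using ENNReal.ofReal_le_ofReal hy
    _ = ENNReal.ofReal (∫ y, (α + β * (r y).toReal + γ * ((r y)⁻¹ ^ t).toReal) ∂ν) := by
        rw [ofReal_integral_eq_lintegral_ofReal i3]
        filter_upwards [hpt, hx] with y hy hy'
        exact (Real.rpow_nonneg hy'.1.le _).trans hy
    _ ≤ ENNReal.ofReal D := by
        apply ENNReal.ofReal_le_ofReal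
        have i4 : Integrable (fun y => α + β * (r y).toReal) ν :=
          (integrable_const α).add (i1.const_mul β)
        rw [integral_add i4 (i2.const_mul γ),
          integral_add (integrable_const α) (i1.const_mul β), integral_const_mul,
          integral_const_mul, v1]
        simp only [integral_const, probReal_univ, smul_eq_mul]
        have := mul_le_mul_of_nonneg_left v2 hγ
        linarith

lemma one_sub_le_integral_min {ε δ : ℝ≥0} (h : DPBound μ ν ε δ) :
    1 - (δ : ℝ) ≤ ∫ y, min (leftDensity μ ν y).toReal
      (Real.exp ε * (leftDensity ν μ y).toReal) ∂(μ + ν) := by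
  have hP := measurable_leftDensity μ ν
  have hQ := measurable_leftDensity ν μ
  have hint : Integrable (fun y => (leftDensity μ ν y).toReal) (μ + ν) :=
    integrable_toReal_of_lintegral_ne_top hP.aemeasurable (by rw [lintegral_leftDensity]; simp)
  have hmin : Integrable (fun y => min (leftDensity μ ν y).toReal
      (Real.exp ε * (leftDensity ν μ y).toReal)) (μ + ν) := by
    refine hint.mono (hP.ennreal_toReal.min (hQ.ennreal_toReal.const_mul _)).aestronglyMeasurable
      (.of_forall fun y => ?_)
    rw [Real.norm_of_nonneg (by positivity), Real.norm_of_nonneg (by positivity)]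
    exact min_le_left _ _
  have h1 : (1 : ℝ≥0∞) ≤ ENNReal.ofReal (∫ y, min (leftDensity μ ν y).toReal
      (Real.exp ε * (leftDensity ν μ y).toReal) ∂(μ + ν)) + δ := by
    rw [ofReal_integral_eq_lintegral_ofReal hmin (.of_forall fun y => by positivity)]
    calc (1 : ℝ≥0∞) = ∫⁻ y, leftDensity μ ν y ∂(μ + ν) := by
          rw [lintegral_leftDensity, measure_univ]
      _ ≤ ∫⁻ y, (ENNReal.ofReal (min (leftDensity μ ν y).toReal
            (Real.exp ε * (leftDensity ν μ y).toReal))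
          + (leftDensity μ ν y - ENNReal.ofReal (Real.exp (ε : ℝ)) * leftDensity ν μ y))
            ∂(μ + ν) := by
          refine lintegral_mono_ae ?_
          filter_upwards [leftDensity_ne_top μ ν, leftDensity_swap_ne_top μ ν] with y h1 h2
          generalize leftDensity μ ν y = p at h1
          generalize leftDensity ν μ y = q at h2
          lift p to ℝ≥0 using h1
          lift q to ℝ≥0 using h2
          rw [ENNReal.coe_toReal, ENNReal.coe_toReal]
          rw [← ENNReal.ofReal_coe_nnreal (p := p), ← ENNReal.ofReal_coe_nnreal (p := q),
            ← ENNReal.ofReal_mul (Real.exp_pos _).le, ← ENNReal.ofReal_sub _ (by positivity)]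
          rcases le_total (p : ℝ) (Real.exp ε * q) with hle | hle
          · rw [min_eq_left hle]; exact le_self_add
          · rw [min_eq_right hle, ← ENNReal.ofReal_add (by positivity) (sub_nonneg.2 hle)]
            simp
      _ ≤ _ := by
          rw [lintegral_add_left' hmin.aemeasurable.ennreal_ofReal]
          gcongr
          exact (dpBound_iff μ ν ε δ).1 h
  rw [← ENNReal.ofReal_coe_nnreal, ← ENNReal.ofReal_add
    (integral_nonneg fun y => by positivity) δ.coe_nonneg, ENNReal.one_le_ofReal] at h1
  linarith

/-- Used to mix densities of masses `a` and `c` so that the mass is at least `s = 1 - δ` yet at most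
`b`. -/
lemma exists_weight {a b c s : ℝ} (ha : s ≤ a) (hb : s ≤ b) (hc : c ≤ b) :
    ∃ θ : ℝ, 0 ≤ θ ∧ θ ≤ 1 ∧ s ≤ θ * a + (1 - θ) * c ∧ θ * a + (1 - θ) * c ≤ b := by
  rcases le_or_gt a b with h | h
  · exact ⟨1, zero_le_one, le_rfl, by linarith, by linarith⟩
  · have hpos : 0 < a - c := by linarith
    have e : (b - c) / (a - c) * a + (1 - (b - c) / (a - c)) * c = b := by
      field_simp; ring
    exact ⟨(b - c) / (a - c), div_nonneg (by linarith) hpos.le,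
      (div_le_one hpos).2 (by linarith), by rw [e]; exact hb, e.le⟩

/-- The map `u ↦ u (p/u)^(1+t)` is decreasing, so the truncated `q'` may replace `q`; the ratio
`p/q'` lies in `[e^(-ε), e^ε]`, where the line applies. -/
lemma moment_le_line {ε t α β p q q' : ℝ} (ht : 0 ≤ t)
    (hbd : ∀ z ∈ Set.Icc (-ε) ε, Real.exp ((1 + t) * z) ≤ α + β * Real.exp z)
    (hq' : 0 ≤ q') (hq : q' ≤ q) (hlow : q' ≤ Real.exp ε * p) (hup : p ≤ Real.exp ε * q') :
    q * (p / q) ^ (1 + t) ≤ α * q' + β * p := by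
  rcases hq'.eq_or_lt with h0 | h0
  · have hp : p = 0 := by
      rw [← h0] at hlow hup
      have := Real.exp_pos ε
      exact le_antisymm (by simpa using hup) (nonneg_of_mul_nonneg_right hlow this)
    have ht' : 1 + t ≠ 0 := by positivity
    simp [← h0, hp, Real.zero_rpow ht']
  have hp : 0 < p := pos_of_mul_pos_right (h0.trans_le hlow) (Real.exp_pos _).le
  have hq0 : 0 < q := h0.trans_le hq
  have key : (p / q') ^ (1 + t) ≤ α + β * (p / q') := by
    have hx : 0 < p / q' := by positivity
    have := hbd (Real.log (p / q')) ⟨?_, ?_⟩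
    · rw [Real.exp_log hx] at this
      rwa [Real.rpow_def_of_pos hx, mul_comm]
    · rw [Real.le_log_iff_exp_le hx, le_div_iff₀ h0, Real.exp_neg, inv_mul_le_iff₀ (Real.exp_pos _)]
      exact hlow
    · rw [Real.log_le_iff_le_exp hx, div_le_iff₀ h0]
      exact hup
  have split : ∀ u : ℝ, 0 < u → u * (p / u) ^ (1 + t) = p * (p / u) ^ t := fun u hu => by
    rw [Real.rpow_add (by positivity), Real.rpow_one]
    field_simp
  calc q * (p / q) ^ (1 + t) = p * (p / q) ^ t := split q hq0
    _ ≤ p * (p / q') ^ t := by gcongr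
    _ = q' * (p / q') ^ (1 + t) := (split q' h0).symm
    _ ≤ q' * (α + β * (p / q')) := by gcongr
    _ = α * q' + β * p := by field_simp

/-- Truncating both densities leaves a pair with ratio in `[e^(-ε), e^ε]` and loses mass at most `δ`
from each. The chord bound then applies as in the pure case, once the masses are ordered correctly.
-/
lemma approxMoment_of_dpBound {t : ℝ} (ht : 0 ≤ t) {ε δ : ℝ≥0} (hμν : DPBound μ ν ε δ)
    (hνμ : DPBound ν μ ε δ) :
    ApproxMoment μ ν t δ (ENNReal.ofReal (Real.exp (1 / 2 * t * (t + 1) * (ε : ℝ) ^ 2))) := by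
  have hP := measurable_leftDensity μ ν
  have hQ := measurable_leftDensity ν μ
  set D := Real.exp (1 / 2 * t * (t + 1) * (ε : ℝ) ^ 2) with hD
  set E := Real.exp (ε : ℝ) with hE
  have hE1 : 1 ≤ E := Real.one_le_exp ε.2
  set p : Y → ℝ := fun y => (leftDensity μ ν y).toReal with hp
  set q : Y → ℝ := fun y => (leftDensity ν μ y).toReal with hq
  have hpm : Measurable p := hP.ennreal_toReal
  have hqm : Measurable q := hQ.ennreal_toReal
  have hp0 : ∀ y, 0 ≤ p y := fun y => ENNReal.toReal_nonneg
  have hq0 : ∀ y, 0 ≤ q y := fun y => ENNReal.toReal_nonneg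
  have hpi : Integrable p (μ + ν) :=
    integrable_toReal_of_lintegral_ne_top hP.aemeasurable (by rw [lintegral_leftDensity]; simp)
  have hqi : Integrable q (μ + ν) :=
    integrable_toReal_of_lintegral_ne_top hQ.aemeasurable
      (by rw [lintegral_leftDensity_swap]; simp)
  have hq1 : ∫ y, q y ∂(μ + ν) = 1 := by
    rw [integral_toReal hQ.aemeasurable, lintegral_leftDensity_swap, measure_univ,
      ENNReal.toReal_one]
    filter_upwards [leftDensity_swap_ne_top μ ν] with y hy using hy.lt_top
  set p₁ : Y → ℝ := fun y => min (p y) (E * q y) with hp₁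
  set q₁ : Y → ℝ := fun y => min (q y) (E * p y) with hq₁
  have hp₁0 : ∀ y, 0 ≤ p₁ y := fun y =>
    le_min (hp0 y) (mul_nonneg (by linarith) (hq0 y))
  have hq₁0 : ∀ y, 0 ≤ q₁ y := fun y =>
    le_min (hq0 y) (mul_nonneg (by linarith) (hp0 y))
  have hp₁m : Measurable p₁ := hpm.min (hqm.const_mul _)
  have hq₁m : Measurable q₁ := hqm.min (hpm.const_mul _)
  have hp₁i : Integrable p₁ (μ + ν) := hpi.mono hp₁m.aestronglyMeasurable
    (.of_forall fun y => by
      rw [Real.norm_of_nonneg (hp₁0 y), Real.norm_of_nonneg (hp0 y)]; exact min_le_left _ _)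
  have hq₁i : Integrable q₁ (μ + ν) := hqi.mono hq₁m.aestronglyMeasurable
    (.of_forall fun y => by
      rw [Real.norm_of_nonneg (hq₁0 y), Real.norm_of_nonneg (hq0 y)]; exact min_le_left _ _)
  have ha : 1 - (δ : ℝ) ≤ ∫ y, p₁ y ∂(μ + ν) := one_sub_le_integral_min hμν
  have hb : 1 - (δ : ℝ) ≤ ∫ y, q₁ y ∂(μ + ν) := by
    rw [add_comm]; exact one_sub_le_integral_min hνμ
  have hb0 : 0 ≤ ∫ y, q₁ y ∂(μ + ν) := integral_nonneg hq₁0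
  have hb1 : ∫ y, q₁ y ∂(μ + ν) ≤ 1 := by
    rw [← hq1]; exact integral_mono hq₁i hqi fun y => min_le_left _ _
  obtain ⟨θ, hθ0, hθ1, hm1, hm2⟩ := exists_weight ha hb
    (div_le_self hb0 hE1)
  have hqp : ∀ y, q₁ y / E ≤ p₁ y := fun y => by
    rw [div_le_iff₀ (by linarith)]
    rcases min_choice (p y) (E * q y) with h | h
    · simp only [hp₁, h]; rw [mul_comm]; exact min_le_right _ _
    · simp only [hp₁, h]
      refine (min_le_left _ _).trans ?_
      have : 1 * 1 ≤ E * E := by gcongr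
      nlinarith [hq0 y]
  have hpq : ∀ y, p₁ y ≤ E * q₁ y := fun y => by
    rcases min_choice (q y) (E * p y) with h | h
    · simp only [hq₁, h]; exact min_le_right _ _
    · simp only [hq₁, h]
      refine (min_le_left _ _).trans ?_
      have : 1 * 1 ≤ E * E := by gcongr
      nlinarith [hp0 y]
  -- Lowering `p₁` towards `q₁ / E` keeps the ratio bounds and brings the mass of `p'` below that of
  -- `q₁`.
  set p' : Y → ℝ := fun y => θ * p₁ y + (1 - θ) * (q₁ y / E) with hp'
  have hp'm : Measurable p' := (hp₁m.const_mul _).add ((hq₁m.div_const _).const_mul _)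
  have hp'i : Integrable p' (μ + ν) := (hp₁i.const_mul _).add ((hq₁i.div_const _).const_mul _)
  have hp'int : ∫ y, p' y ∂(μ + ν)
      = θ * ∫ y, p₁ y ∂(μ + ν) + (1 - θ) * ((∫ y, q₁ y ∂(μ + ν)) / E) := by
    rw [hp', integral_add (hp₁i.const_mul _) ((hq₁i.div_const _).const_mul _),
      integral_const_mul, integral_const_mul, integral_div]
  have hp'0 : ∀ y, 0 ≤ p' y := fun y => add_nonneg (mul_nonneg hθ0 (hp₁0 y))
    (mul_nonneg (by linarith) (div_nonneg (hq₁0 y) (by linarith)))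
  have hp'p₁ : ∀ y, p' y ≤ p₁ y := fun y => by
    have := mul_le_mul_of_nonneg_left (hqp y) (sub_nonneg.2 hθ1)
    simp only [hp']; linarith
  have hp'q₁ : ∀ y, q₁ y / E ≤ p' y := fun y => by
    have := mul_le_mul_of_nonneg_left (hqp y) hθ0
    simp only [hp']; linarith
  obtain ⟨α, β, hα, hsum, hbd⟩ := exists_line_bound (ε := ε) ε.2 ht
  have hline : ∀ y, q y * (p' y / q y) ^ (1 + t) ≤ α * q₁ y + β * p' y := fun y => by
    refine moment_le_line ht hbd (hq₁0 y) (min_le_left _ _) ?_ ((hp'p₁ y).trans (hpq y))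
    have := hp'q₁ y
    rwa [div_le_iff₀ (by linarith), mul_comm] at this
  have hr : Measurable fun y => ENNReal.ofReal (p' y / q y) := (hp'm.div hqm).ennreal_ofReal
  have hw : ν.withDensity (fun y => ENNReal.ofReal (p' y / q y))
      = (μ + ν).withDensity fun y => ENNReal.ofReal (p' y) := by
    have h1 := withDensity_mul (μ + ν) hQ hr
    rw [withDensity_leftDensity_swap] at h1
    rw [← h1]
    refine withDensity_congr_ae ?_
    filter_upwards [leftDensity_swap_ne_top μ ν] with y hy
    rw [Pi.mul_apply, ← ENNReal.ofReal_toReal hy, ← ENNReal.ofReal_mul ENNReal.toReal_nonneg]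
    congr 1
    rcases (hq0 y).eq_or_lt with h0 | h0
    · have : p' y ≤ 0 := (hp'p₁ y).trans ((min_le_right _ _).trans (by rw [← h0, mul_zero]))
      rw [le_antisymm this (hp'0 y)]; simp
    · exact mul_div_cancel₀ _ h0.ne'
  refine ⟨_, hr, ?_, ?_, ?_⟩
  · rw [hw]
    refine (withDensity_mono ?_).trans (withDensity_leftDensity μ ν).le
    exact .of_forall fun y => ENNReal.ofReal_le_of_le_toReal ((hp'p₁ y).trans (min_le_left _ _))
  · rw [hw, withDensity_apply _ MeasurableSet.univ, setLIntegral_univ,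
      ← ofReal_integral_eq_lintegral_ofReal hp'i (.of_forall hp'0), measure_univ,
      ← ENNReal.ofReal_coe_nnreal, ← ENNReal.ofReal_add (integral_nonneg hp'0) δ.coe_nonneg,
      ENNReal.one_le_ofReal, hp'int]
    linarith
  · have h1 := lintegral_withDensity_eq_lintegral_mul (μ + ν) hQ (hr.pow_const (1 + t))
    rw [withDensity_leftDensity_swap] at h1
    have hi : Integrable (fun y => α * q₁ y + β * p' y) (μ + ν) :=
      (hq₁i.const_mul _).add (hp'i.const_mul _)
    have hnn : ∀ y, 0 ≤ α * q₁ y + β * p' y := fun y =>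
      (mul_nonneg (hq0 y) (Real.rpow_nonneg (div_nonneg (hp'0 y) (hq0 y)) _)).trans (hline y)
    calc ∫⁻ y, ENNReal.ofReal (p' y / q y) ^ (1 + t) ∂ν
        = ∫⁻ y, (leftDensity ν μ * fun y => ENNReal.ofReal (p' y / q y) ^ (1 + t)) y ∂(μ + ν) := h1
      _ ≤ ∫⁻ y, ENNReal.ofReal (α * q₁ y + β * p' y) ∂(μ + ν) := by
          refine lintegral_mono_ae ?_
          filter_upwards [leftDensity_swap_ne_top μ ν] with y hy
          rw [Pi.mul_apply, ← ENNReal.ofReal_toReal hy,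
            ENNReal.ofReal_rpow_of_nonneg (div_nonneg (hp'0 y) (hq0 y)) (by positivity),
            ← ENNReal.ofReal_mul ENNReal.toReal_nonneg]
          exact ENNReal.ofReal_le_ofReal (hline y)
      _ = ENNReal.ofReal (∫ y, (α * q₁ y + β * p' y) ∂(μ + ν)) :=
          (ofReal_integral_eq_lintegral_ofReal hi (.of_forall hnn)).symm
      _ ≤ ENNReal.ofReal D := by
          apply ENNReal.ofReal_le_ofReal
          rw [integral_add (hq₁i.const_mul _) (hp'i.const_mul _), integral_const_mul,
            integral_const_mul]
          rw [← hp'int] at hm2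
          have hm0 : 0 ≤ ∫ y, p' y ∂(μ + ν) := integral_nonneg hp'0
          -- Since `α ≤ 0` and `∫ p' ≤ ∫ q₁`, the integral is at most `(α + β) ∫ p' ≤ D ∫ p' ≤ D`.
          have e1 := mul_le_mul_of_nonpos_left hm2 hα
          have e2 := mul_le_mul_of_nonneg_right hsum hm0
          have e3 : D * ∫ y, p' y ∂(μ + ν) ≤ D * 1 :=
            mul_le_mul_of_nonneg_left (hm2.trans hb1) (Real.exp_pos _).le
          linarith

lemma approxMoment_of_roundCondition {t : ℝ} (ht : 0 < t) {ε δ : ℝ≥0}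
    (hμν : RoundCondition μ ν t ε δ) (hνμ : RoundCondition ν μ t ε δ) :
    ApproxMoment μ ν t δ (ENNReal.ofReal (Real.exp (1 / 2 * t * (t + 1) * (ε : ℝ) ^ 2))) := by
  rcases hμν with h | ⟨rfl, h⟩
  · rcases hνμ with h' | ⟨rfl, h'⟩
    · exact approxMoment_of_dpBound ht.le h h'
    · exact approxMoment_of_mixed ht h h'
  · exact approxMoment_of_renyiBound ht h

end OneStep

end OneRound

/-! ### Measurability of the privacy conditions in the history -/

section Measurability

variable {α Y : Type*} [MeasurableSpace α] [MeasurableSpace Y]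
  [MeasurableSpace.CountableOrCountablyGenerated α Y] (κ η : Kernel α Y) [IsFiniteKernel κ]
  [IsFiniteKernel η]

lemma kernel_rnDeriv_ae_eq_leftDensity (a : α) :
    κ.rnDeriv (κ + η) a =ᵐ[κ a + η a] leftDensity (κ a) (η a) := by
  have := Kernel.rnDeriv_eq_rnDeriv_measure (κ := κ) (η := κ + η) (a := a)
  rwa [add_apply] at this

lemma kernel_rnDeriv_ae_eq_leftDensity_swap (a : α) :
    η.rnDeriv (κ + η) a =ᵐ[κ a + η a] leftDensity (η a) (κ a) := by
  rw [add_comm κ η, add_comm (κ a)]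
  exact kernel_rnDeriv_ae_eq_leftDensity η κ a

lemma measurableSet_dpBound {ε δ : α → ℝ≥0} (hε : Measurable ε) (hδ : Measurable δ) :
    MeasurableSet {a | DPBound (κ a) (η a) (ε a) (δ a)} := by
  have e : {a | DPBound (κ a) (η a) (ε a) (δ a)} = {a | ∫⁻ y, (κ.rnDeriv (κ + η) a y
      - ENNReal.ofReal (Real.exp (ε a : ℝ)) * η.rnDeriv (κ + η) a y) ∂(κ + η) a ≤ δ a} := by
    ext a
    rw [Set.mem_ofPred_eq, Set.mem_ofPred_eq, dpBound_iff, add_apply]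
    refine Eq.to_iff (congrArg (· ≤ _) (lintegral_congr_ae ?_))
    filter_upwards [kernel_rnDeriv_ae_eq_leftDensity κ η a,
      kernel_rnDeriv_ae_eq_leftDensity_swap κ η a] with y h1 h2
    rw [h1, h2]
  rw [e]
  refine measurableSet_le ?_ hδ.coe_nnreal_ennreal
  refine Measurable.lintegral_kernel_prod_right (κ := κ + η) ?_
  refine (Kernel.measurable_rnDeriv κ (κ + η)).sub
    (Measurable.mul ?_ (Kernel.measurable_rnDeriv η (κ + η)))
  exact (Real.measurable_exp.comp (hε.coe_nnreal_real.comp measurable_fst)).ennreal_ofReal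

lemma measurableSet_renyiBound {ε : α → ℝ≥0} (hε : Measurable ε) (t : ℝ) :
    MeasurableSet {a | RenyiBound (κ a) (η a) t (ε a)} := by
  have e : {a | RenyiBound (κ a) (η a) t (ε a)} = {a | ∫⁻ y, (κ.rnDeriv (κ + η) a y
      / η.rnDeriv (κ + η) a y) ^ t ∂κ a
        ≤ ENNReal.ofReal (Real.exp (1 / 2 * t * (t + 1) * (ε a : ℝ) ^ 2))} := by
    ext a
    rw [Set.mem_ofPred_eq, Set.mem_ofPred_eq, RenyiBound]
    refine Eq.to_iff (congrArg (· ≤ _) (lintegral_congr_ae ?_))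
    have hac : κ a ≪ κ a + η a := Measure.AbsolutelyContinuous.rfl.add_right _
    filter_upwards [hac.ae_le (kernel_rnDeriv_ae_eq_leftDensity κ η a),
      hac.ae_le (kernel_rnDeriv_ae_eq_leftDensity_swap κ η a)] with y h1 h2
    rw [h1, h2]
  rw [e]
  refine measurableSet_le ?_ ?_
  · refine Measurable.lintegral_kernel_prod_right (κ := κ) ?_
    exact ((Kernel.measurable_rnDeriv κ (κ + η)).div
      (Kernel.measurable_rnDeriv η (κ + η))).pow_const t
  · exact (Real.measurable_exp.comp ((hε.coe_nnreal_real.pow_const 2).const_mul _)).ennreal_ofReal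

/-- Jointly measurable kernel densities exist under the countability assumption. Fixing a single
order `t` avoids an intersection over all real orders. -/
lemma measurableSet_roundCondition {ε δ : α → ℝ≥0} (hε : Measurable ε) (hδ : Measurable δ)
    (t : ℝ) : MeasurableSet {a | RoundCondition (κ a) (η a) t (ε a) (δ a)} :=
  (measurableSet_dpBound κ η hε hδ).union
    ((hδ (measurableSet_singleton 0)).inter (measurableSet_renyiBound κ η hε t))

end Measurability

/-! ### Costs, values and backward induction along histories -/

section Histories

variable {Y : Type*}

/-- Append one output to a history. -/
def append {m : ℕ} (h : Fin m → Y) (y : Y) : Fin (m + 1) → Y := Fin.snoc (α := fun _ => Y) h y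

lemma history_succ (a : ℕ → Y) (m : ℕ) : history a (m + 1) = append (history a m) (a m) := by
  funext i
  refine Fin.lastCases ?_ (fun j => ?_) i
  · simp [history, append]
  · simp [history, append]

lemma measurable_append [MeasurableSpace Y] (m : ℕ) :
    Measurable fun z : (Fin m → Y) × Y => append z.1 z.2 := by
  refine measurable_pi_iff.2 fun i => ?_
  refine Fin.lastCases ?_ (fun j => ?_) i
  · simpa [append] using measurable_snd
  · simp only [append, Fin.snoc_castSucc]
    exact (measurable_pi_apply j).comp measurable_fst

/-- The total of a cost over the rounds of a history, where the cost of a round is a function of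
the outputs before it. -/
def spent (c : ∀ m, (Fin m → Y) → ℝ) (m : ℕ) (h : Fin m → Y) : ℝ :=
  ∑ j : Fin m, c j fun i => h (Fin.castLE j.2.le i)

lemma spent_append (c : ∀ m, (Fin m → Y) → ℝ) {m : ℕ} (h : Fin m → Y) (y : Y) :
    spent c (m + 1) (append h y) = spent c m h + c m h := by
  have key : ∀ i : Fin m, append h y i.castSucc = h i := fun i => by simp [append]
  rw [spent, Fin.sum_univ_castSucc]
  congr 1
  · refine Finset.sum_congr rfl fun j _ => ?_
    congr 1; funext i; exact key (Fin.castLE j.2.le i)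
  · show c m _ = c m h
    congr 1; funext i; exact key i

lemma spent_history (c : ∀ m, (Fin m → Y) → ℝ) (a : ℕ → Y) (m : ℕ) :
    spent c m (history a m) = ∑ j ∈ Finset.range m, c j (history a j) := by
  rw [spent, Finset.sum_range]
  rfl

lemma measurable_spent [MeasurableSpace Y] {c : ∀ m, (Fin m → Y) → ℝ}
    (hc : ∀ m, Measurable (c m)) (m : ℕ) : Measurable (spent c m) :=
  Finset.measurable_fun_sum _ fun j _ => (hc j).comp (measurable_pi_iff.2 fun _ =>
    measurable_pi_apply _)

section Value

variable [MeasurableSpace Y] (κ : ∀ m, Kernel (Fin m → Y) Y) (cont : ∀ m, Set (Fin m → Y))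
  (g : ∀ m, (Fin m → Y) → ℝ≥0∞)

open Classical in
/-- The expected final payoff given the history `h`, when at most `k` more rounds are run, round
`m` is run only if the history is in `cont m`, and the payoff of ending with history `h` is
`g m h`. -/
noncomputable def value : ℕ → ∀ m, (Fin m → Y) → ℝ≥0∞
  | 0, m, h => g m h
  | k + 1, m, h => if h ∈ cont m then ∫⁻ y, value k (m + 1) (append h y) ∂κ m h else g m h

variable {cont g}

lemma measurable_value [∀ m, IsSFiniteKernel (κ m)] (hcont : ∀ m, MeasurableSet (cont m))
    (hg : ∀ m, Measurable (g m)) (k m : ℕ) : Measurable (value κ cont g k m) := by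
  classical
  induction k generalizing m with
  | zero => exact hg m
  | succ k ih =>
    refine Measurable.ite (hcont m) ?_ (hg m)
    exact Measurable.lintegral_kernel_prod_right ((ih (m + 1)).comp (measurable_append m))

lemma value_le_one [∀ m, IsMarkovKernel (κ m)] (hg : ∀ m h, g m h ≤ 1) (k m : ℕ)
    (h : Fin m → Y) : value κ cont g k m h ≤ 1 := by
  induction k generalizing m with
  | zero => exact hg m h
  | succ k ih =>
    rw [value]
    split_ifs
    · calc ∫⁻ y, value κ cont g k (m + 1) (append h y) ∂κ m h ≤ ∫⁻ _, 1 ∂κ m h :=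
            lintegral_mono fun y => ih _ _
        _ = 1 := by simp
    · exact hg m h

/-- The history is in `C` now and, almost surely, in each of the next rounds. -/
def AlmostSurelyIn (C : ∀ m, Set (Fin m → Y)) : ℕ → ∀ m, (Fin m → Y) → Prop
  | 0, _, _ => True
  | k + 1, m, h => h ∈ C m ∧ ∀ᵐ y ∂κ m h, AlmostSurelyIn C k (m + 1) (append h y)

lemma ae_almostSurelyIn [∀ m, IsSFiniteKernel (κ m)] {Q : ∀ m, Measure (Fin m → Y)}
    [∀ m, SFinite (Q m)]
    (hQ : ∀ m, Q (m + 1) = (Q m ⊗ₘ κ m).map fun z => append z.1 z.2)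
    {C : ∀ m, Set (Fin m → Y)} (hC : ∀ m, ∀ᵐ h ∂Q m, h ∈ C m) (k m : ℕ) :
    ∀ᵐ h ∂Q m, AlmostSurelyIn κ C k m h := by
  induction k generalizing m with
  | zero => exact .of_forall fun _ => trivial
  | succ k ih =>
    have h1 := ih (m + 1)
    rw [hQ] at h1
    have h2 := Measure.ae_ae_of_ae_compProd
      (ae_of_ae_map (measurable_append m).aemeasurable h1)
    filter_upwards [hC m, h2] with h h3 h4 using ⟨h3, h4⟩

end Value

/-- Either `w ≤ e^ε`, or `e^(-ε) w ≥ 1` and its `t`-th power only helps. This is the payoff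
inequality at stopping. -/
lemma mul_le_exp_add_rpow {ε t : ℝ} (ht : 0 < t) {w c X : ℝ≥0∞} (hc : c ≤ 1) (hX : 1 ≤ X) :
    w * c ≤ ENNReal.ofReal (Real.exp ε) * c
      + ENNReal.ofReal (Real.exp (-(t * ε))) * w ^ (1 + t) * X := by
  rcases le_total w (ENNReal.ofReal (Real.exp ε)) with h | h
  · exact le_add_right (by gcongr)
  · refine le_add_left ?_
    have h1 : 1 ≤ ENNReal.ofReal (Real.exp (-ε)) * w := by
      calc (1 : ℝ≥0∞) = ENNReal.ofReal (Real.exp (-ε)) * ENNReal.ofReal (Real.exp ε) := by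
            rw [← ENNReal.ofReal_mul (Real.exp_pos _).le, ← Real.exp_add]; simp
        _ ≤ _ := by gcongr
    calc w * c ≤ w * 1 := by gcongr
      _ ≤ w * (ENNReal.ofReal (Real.exp (-ε)) * w) ^ t := by
          gcongr; exact ENNReal.one_le_rpow h1 ht
      _ = ENNReal.ofReal (Real.exp (-(t * ε))) * w ^ (1 + t) * 1 := by
          rw [ENNReal.mul_rpow_of_nonneg _ _ ht.le, ENNReal.ofReal_rpow_of_pos (Real.exp_pos _),
            ENNReal.rpow_add_of_nonneg _ _ zero_le_one ht.le, ENNReal.rpow_one, ← Real.exp_mul,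
            mul_one, neg_mul, mul_comm ε t]
          ring
      _ ≤ _ := by gcongr

section BackwardInduction

variable [MeasurableSpace Y] {κ κ' : ∀ m, Kernel (Fin m → Y) Y} [∀ m, IsMarkovKernel (κ m)]
  [∀ m, IsMarkovKernel (κ' m)] {εs δs : ∀ m, (Fin m → Y) → ℝ≥0} {g : ∀ m, (Fin m → Y) → ℝ≥0∞}

/-- The histories after which one more round keeps the sum of the squares `ε_m²` below `V` and
that of the `δ_m` below `δ`. -/
def budgetSet (εs δs : ∀ m, (Fin m → Y) → ℝ≥0) (V δ : ℝ) (m : ℕ) : Set (Fin m → Y) :=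
  {h | spent (fun m h => (εs m h : ℝ) ^ 2) m h + (εs m h : ℝ) ^ 2 ≤ V ∧
    spent (fun m h => (δs m h : ℝ)) m h + (δs m h : ℝ) ≤ δ}

lemma measurableSet_budgetSet (hεs : ∀ m, Measurable (εs m)) (hδs : ∀ m, Measurable (δs m))
    (V δ : ℝ) (m : ℕ) : MeasurableSet (budgetSet εs δs V δ m) := by
  have h1 : ∀ m, Measurable fun h => (εs m h : ℝ) ^ 2 := fun m =>
    (hεs m).coe_nnreal_real.pow_const 2
  have h2 : ∀ m, Measurable fun h => (δs m h : ℝ) := fun m => (hδs m).coe_nnreal_real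
  exact (measurableSet_le ((measurable_spent h1 m).add (h1 m)) measurable_const).inter
    (measurableSet_le ((measurable_spent h2 m).add (h2 m)) measurable_const)

/-- One step of the backward induction: if the claim holds after the next round, it holds
before it. -/
lemma ratio_step {μ ν : Measure Y} [IsProbabilityMeasure μ] [IsProbabilityMeasure ν]
    {t : ℝ} (ht : 0 ≤ t) {δ C K c w Δ X : ℝ≥0∞} (happ : ApproxMoment μ ν t δ C)
    {F F' : Y → ℝ≥0∞} (hF : Measurable F) (hF' : Measurable F') (hF1 : ∀ y, F y ≤ 1)
    {p p' : Y → Prop} (hp : ∀ᵐ y ∂μ, p y) (hp' : ∀ᵐ y ∂ν, p' y)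
    (hstep : ∀ y, p y → p' y → ∀ w : ℝ≥0∞, w * F y ≤ K * F' y + w * Δ + c * w ^ (1 + t) * X) :
    w * ∫⁻ y, F y ∂μ ≤ K * ∫⁻ y, F' y ∂ν + w * (δ + Δ) + c * w ^ (1 + t) * (C * X) := by
  obtain ⟨r, hr, hle, huniv, hmom⟩ := happ
  have hr1 : ∫⁻ y, r y ∂ν ≤ 1 := by
    have := hle Set.univ
    rwa [withDensity_apply _ MeasurableSet.univ, setLIntegral_univ, measure_univ] at this
  -- A `μ`-null set may be charged by `ν`, but only where `r = 0`; there the claim is trivial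
  -- because the ratio `w r` vanishes.
  have hpr : ∀ᵐ y ∂ν, r y ≠ 0 → p y := (ae_withDensity_iff hr).1 (ae_mono hle hp)
  have hrt : Measurable fun y => (w * r y) ^ (1 + t) := (hr.const_mul w).pow_const _
  calc w * ∫⁻ y, F y ∂μ ≤ w * (∫⁻ y, F y ∂ν.withDensity r + δ) := by
        gcongr; exact lintegral_le_of_le_of_univ_le hle huniv hF1
    _ = ∫⁻ y, w * r y * F y ∂ν + w * δ := by
        rw [lintegral_withDensity_eq_lintegral_mul _ hr hF, mul_add,
          ← lintegral_const_mul _ (hr.mul hF)]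
        simp only [Pi.mul_apply, mul_assoc]
    _ ≤ ∫⁻ y, (K * F' y + w * r y * Δ + c * (w * r y) ^ (1 + t) * X) ∂ν + w * δ := by
        gcongr ?_ + _
        refine lintegral_mono_ae ?_
        filter_upwards [hpr, hp'] with y h1 h2
        by_cases h0 : r y = 0
        · simp [h0]
        · exact hstep y (h1 h0) h2 _
    _ = K * ∫⁻ y, F' y ∂ν + w * (∫⁻ y, r y ∂ν) * Δ
          + c * (w ^ (1 + t) * ∫⁻ y, r y ^ (1 + t) ∂ν) * X + w * δ := by
        rw [lintegral_add_right _ ((hrt.const_mul c).mul_const X),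
          lintegral_add_left (hF'.const_mul K), lintegral_const_mul _ hF',
          lintegral_mul_const _ (hr.const_mul w), lintegral_const_mul _ hr,
          lintegral_mul_const _ (hrt.const_mul c), lintegral_const_mul _ hrt,
          ← lintegral_const_mul _ (hr.pow_const (1 + t))]
        simp only [ENNReal.mul_rpow_of_nonneg _ _ (by positivity : 0 ≤ 1 + t)]
    _ ≤ K * ∫⁻ y, F' y ∂ν + w * 1 * Δ + c * (w ^ (1 + t) * C) * X + w * δ := by gcongr
    _ = K * ∫⁻ y, F' y ∂ν + w * (δ + Δ) + c * w ^ (1 + t) * (C * X) := by ring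

/-- The ratio `w` must be arbitrary, since the step invokes the claim at `w r(y)`. A round is run
only if both budgets survive it, so the remaining budgets stay nonnegative. -/
lemma ratio_mul_value_le {ε t V δ : ℝ} (ht : 0 < t) (hεs : ∀ m, Measurable (εs m))
    (hδs : ∀ m, Measurable (δs m)) (hg : ∀ m, Measurable (g m)) (hg1 : ∀ m h, g m h ≤ 1)
    (k m : ℕ) (h : Fin m → Y)
    (hV : spent (fun m h => (εs m h : ℝ) ^ 2) m h ≤ V)
    (hδ : spent (fun m h => (δs m h : ℝ)) m h ≤ δ)
    (hgood : AlmostSurelyIn κ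
      (fun m => {h | RoundCondition (κ m h) (κ' m h) t (εs m h) (δs m h)}) k m h)
    (hgood' : AlmostSurelyIn κ'
      (fun m => {h | RoundCondition (κ' m h) (κ m h) t (εs m h) (δs m h)}) k m h)
    (w : ℝ≥0∞) :
    w * value κ (budgetSet εs δs V δ) g k m h
      ≤ ENNReal.ofReal (Real.exp ε) * value κ' (budgetSet εs δs V δ) g k m h
        + w * ENNReal.ofReal (δ - spent (fun m h => (δs m h : ℝ)) m h)
        + ENNReal.ofReal (Real.exp (-(t * ε))) * w ^ (1 + t) * ENNReal.ofReal
          (Real.exp (1 / 2 * t * (t + 1) * (V - spent (fun m h => (εs m h : ℝ) ^ 2) m h))) := by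
  have hcont := measurableSet_budgetSet hεs hδs V δ
  have terminal : ∀ (w : ℝ≥0∞) m h, spent (fun m h => (εs m h : ℝ) ^ 2) m h ≤ V → w * g m h
      ≤ ENNReal.ofReal (Real.exp ε) * g m h
        + w * ENNReal.ofReal (δ - spent (fun m h => (δs m h : ℝ)) m h)
        + ENNReal.ofReal (Real.exp (-(t * ε))) * w ^ (1 + t) * ENNReal.ofReal
          (Real.exp (1 / 2 * t * (t + 1) * (V - spent (fun m h => (εs m h : ℝ) ^ 2) m h))) := by
    intro w m h hV
    rw [add_right_comm]
    refine le_add_right (mul_le_exp_add_rpow ht (hg1 m h) ?_)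
    rw [ENNReal.one_le_ofReal]
    exact Real.one_le_exp (mul_nonneg (by positivity) (sub_nonneg.2 hV))
  induction k generalizing m w with
  | zero => exact terminal w m h hV
  | succ k ih =>
    rw [value, value]
    split_ifs with hc
    · have hδ' : 0 ≤ δ - (spent (fun m h => (δs m h : ℝ)) m h + δs m h) := sub_nonneg.2 hc.2
      have key := ratio_step (w := w) (K := ENNReal.ofReal (Real.exp ε))
        (c := ENNReal.ofReal (Real.exp (-(t * ε))))
        (Δ := ENNReal.ofReal (δ - (spent (fun m h => (δs m h : ℝ)) m h + δs m h)))
        (X := ENNReal.ofReal (Real.exp (1 / 2 * t * (t + 1)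
          * (V - (spent (fun m h => (εs m h : ℝ) ^ 2) m h + (εs m h : ℝ) ^ 2)))))
        (F := fun y => value κ (budgetSet εs δs V δ) g k (m + 1) (append h y))
        (F' := fun y => value κ' (budgetSet εs δs V δ) g k (m + 1) (append h y))
        ht.le (approxMoment_of_roundCondition ht hgood.1 hgood'.1)
        ((measurable_value κ hcont hg k (m + 1)).comp
          ((measurable_append m).comp measurable_prodMk_left))
        ((measurable_value κ' hcont hg k (m + 1)).comp
          ((measurable_append m).comp measurable_prodMk_left))
        (fun y => value_le_one κ hg1 k (m + 1) _) hgood.2 hgood'.2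
        (fun y h1 h2 w' => by
          have := ih (m + 1) (append h y) (by rw [spent_append]; exact hc.1)
            (by rw [spent_append]; exact hc.2) h1 h2 w'
          rwa [spent_append, spent_append] at this)
      rw [← ENNReal.ofReal_coe_nnreal, ← ENNReal.ofReal_add (NNReal.coe_nonneg _) hδ',
        ← ENNReal.ofReal_mul (Real.exp_pos _).le, ← Real.exp_add] at key
      convert key using 4
      · congr 1; ring
      · congr 2; ring
    · exact terminal w m h hV

end BackwardInduction

end Histories

/-! ### Exit times and the law of the stopped process -/

section Stopping

variable {Y : Type*} {cont : ∀ m, Set (Fin m → Y)}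

/-- The first round before which the history leaves the sets `cont n`. -/
noncomputable def exitTime (cont : ∀ m, Set (Fin m → Y)) (a : ℕ → Y) : ℕ∞ :=
  sInf ((fun n : ℕ => (n : ℕ∞)) '' {n | history a n ∉ cont n})

lemma natCast_le_exitTime {a : ℕ → Y} {m : ℕ} :
    (m : ℕ∞) ≤ exitTime cont a ↔ ∀ j < m, history a j ∈ cont j := by
  rw [exitTime, le_sInf_iff, Set.forall_mem_image]
  refine ⟨fun h j hj => ?_, fun h j hj => ?_⟩
  · by_contra hc
    exact absurd (Nat.cast_le.1 (h hc)) (by omega)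
  · by_contra hc
    exact hj (h j (by simpa using hc))

lemma natCast_lt_exitTime {a : ℕ → Y} {m : ℕ} :
    (m : ℕ∞) < exitTime cont a ↔ ∀ j ≤ m, history a j ∈ cont j := by
  rw [← ENat.add_one_le_iff (ENat.natCast_ne_top m), ← Nat.cast_one, ← Nat.cast_add,
    natCast_le_exitTime]
  simp

lemma exitTime_le {a : ℕ → Y} {m : ℕ} (h : history a m ∉ cont m) : exitTime cont a ≤ m :=
  sInf_le ⟨m, h, rfl⟩

/-- A finite history, padded with the terminating symbol. -/
def pad {m : ℕ} (h : Fin m → Y) : ℕ → Y ⊕ Unit :=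
  fun n => if hn : n < m then Sum.inl (h ⟨n, hn⟩) else Sum.inr ()

lemma pad_history (a : ℕ → Y) (m : ℕ) : pad (history a m) = stopAt m a := by
  funext n
  simp only [pad, stopAt, history, Nat.cast_lt]
  split_ifs <;> rfl

open Classical in
/-- The payoff of a sequence of outputs that is stopped after at most `k` rounds from round `m`
on, or when the history leaves `cont`. -/
noncomputable def stoppedPayoff (cont : ∀ m, Set (Fin m → Y)) (g : ∀ m, (Fin m → Y) → ℝ≥0∞) :
    ℕ → ℕ → (ℕ → Y) → ℝ≥0∞
  | 0, m, a => g m (history a m)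
  | k + 1, m, a =>
    if history a m ∈ cont m then stoppedPayoff cont g k (m + 1) a else g m (history a m)

lemma stoppedPayoff_pad (f : (ℕ → Y ⊕ Unit) → ℝ≥0∞) (k m : ℕ) (a : ℕ → Y)
    (hm : (m : ℕ∞) ≤ exitTime cont a) :
    stoppedPayoff cont (fun _ h => f (pad h)) k m a
      = f (stopAt (min (exitTime cont a) (m + k : ℕ)) a) := by
  induction k generalizing m with
  | zero => rw [stoppedPayoff, pad_history, add_zero, min_eq_right hm]
  | succ k ih =>
    rw [stoppedPayoff]
    split_ifs with hc
    · rw [ih (m + 1), Nat.add_right_comm, Nat.add_assoc]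
      rw [natCast_le_exitTime] at hm ⊢
      intro j hj
      rcases Nat.lt_succ_iff_lt_or_eq.1 hj with h | rfl
      · exact hm j h
      · exact hc
    · have : exitTime cont a = m := le_antisymm (exitTime_le hc) hm
      rw [pad_history, this, min_eq_left (Nat.cast_le.2 (Nat.le_add_right _ _))]

variable [MeasurableSpace Y]

lemma measurable_pad (m : ℕ) : Measurable (pad : (Fin m → Y) → ℕ → Y ⊕ Unit) := by
  refine measurable_pi_iff.2 fun n => ?_
  by_cases hn : n < m
  · simp only [pad, hn, dif_pos]
    exact measurable_inl.comp (measurable_pi_apply _)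
  · simp only [pad, hn]
    exact measurable_const

variable {Ω : Type*} [MeasurableSpace Ω] {P : Measure Ω} {A : ℕ → Ω → Y}

lemma measurable_history (hA : ∀ n, Measurable (A n)) (m : ℕ) :
    Measurable fun ω => history (fun n => A n ω) m :=
  measurable_pi_iff.2 fun _ => hA _

lemma measurable_stopAt_exitTime (hA : ∀ n, Measurable (A n))
    (hcont : ∀ m, MeasurableSet (cont m)) :
    Measurable fun ω => stopAt (exitTime cont fun n => A n ω) fun n => A n ω := by
  refine measurable_pi_iff.2 fun n => ?_
  refine Measurable.ite ?_ (measurable_inl.comp (hA n)) measurable_const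
  simp only [natCast_lt_exitTime]
  have : {ω | ∀ j ≤ n, history (fun n => A n ω) j ∈ cont j}
      = ⋂ j ∈ Set.Iic n, {ω | history (fun n => A n ω) j ∈ cont j} := by
    ext ω; simp
  rw [this]
  exact MeasurableSet.biInter (Set.to_countable _) fun j _ => measurable_history hA j (hcont j)

variable {κ : ∀ m, Kernel (Fin m → Y) Y} [∀ m, IsMarkovKernel (κ m)]
  {g : ∀ m, (Fin m → Y) → ℝ≥0∞}

lemma lintegral_history_succ [IsProbabilityMeasure P] (hA : ∀ n, Measurable (A n))
    {m : ℕ} (hκ : HasCondDistrib (A m) (fun ω => history (fun n => A n ω) m) (κ m) P)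
    {F : (Fin m → Y) → (Fin (m + 1) → Y) → ℝ≥0∞}
    (hF : Measurable fun z : (Fin m → Y) × Y => F z.1 (append z.1 z.2)) :
    ∫⁻ ω, F (history (fun n => A n ω) m) (history (fun n => A n ω) (m + 1)) ∂P
      = ∫⁻ ω, ∫⁻ y, F (history (fun n => A n ω) m) (append (history (fun n => A n ω) m) y)
          ∂κ m (history (fun n => A n ω) m) ∂P := by
  have hm := measurable_history hA m
  calc ∫⁻ ω, F (history (fun n => A n ω) m) (history (fun n => A n ω) (m + 1)) ∂P
      = ∫⁻ ω, (fun z : (Fin m → Y) × Y => F z.1 (append z.1 z.2))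
          (history (fun n => A n ω) m, A m ω) ∂P := by simp only [history_succ]
    _ = ∫⁻ z, F z.1 (append z.1 z.2) ∂(P.map (fun ω => history (fun n => A n ω) m) ⊗ₘ κ m) := by
        rw [← hκ.map_eq, lintegral_map hF (hm.prodMk (hA m))]
    _ = _ := by
        have : IsProbabilityMeasure (P.map fun ω => history (fun n => A n ω) m) :=
          Measure.isProbabilityMeasure_map hm.aemeasurable
        rw [Measure.lintegral_compProd hF, lintegral_map _ hm]
        exact Measurable.lintegral_kernel_prod_right hF

/-- The weight `φ` makes the induction close: the event of continuing at round `m` depends on the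
history and is absorbed into the weight for round `m + 1`. -/
lemma lintegral_mul_stoppedPayoff [IsProbabilityMeasure P] (hA : ∀ n, Measurable (A n))
    (hκ : ∀ m, HasCondDistrib (A m) (fun ω => history (fun n => A n ω) m) (κ m) P)
    (hcont : ∀ m, MeasurableSet (cont m)) (hg : ∀ m, Measurable (g m)) (k m : ℕ)
    {φ : (Fin m → Y) → ℝ≥0∞} (hφ : Measurable φ) :
    ∫⁻ ω, φ (history (fun n => A n ω) m) * stoppedPayoff cont g k m (fun n => A n ω) ∂P
      = ∫⁻ ω, φ (history (fun n => A n ω) m)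
          * value κ cont g k m (history (fun n => A n ω) m) ∂P := by
  induction k generalizing m with
  | zero => rfl
  | succ k ih =>
    have hh := measurable_history hA m
    set H : Ω → Fin m → Y := fun ω => history (fun n => A n ω) m with hH
    have hinit : ∀ ω, Fin.init (history (fun n => A n ω) (m + 1)) = H ω := fun ω => rfl
    have hmi : Measurable (fun h : Fin (m + 1) → Y => Fin.init (α := fun _ => Y) h) :=
      measurable_pi_iff.2 fun i => measurable_pi_apply _
    have hφ1 : Measurable ((cont m).indicator φ) := hφ.indicator (hcont m)
    have hφ2 : Measurable ((cont m)ᶜ.indicator φ) := hφ.indicator (hcont m).compl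
    have e1 : ∀ ω, φ (H ω) * stoppedPayoff cont g (k + 1) m (fun n => A n ω)
        = (cont m)ᶜ.indicator φ (H ω) * g m (H ω)
          + (cont m).indicator φ (Fin.init (history (fun n => A n ω) (m + 1)))
            * stoppedPayoff cont g k (m + 1) (fun n => A n ω) := fun ω => by
      rw [hinit, stoppedPayoff]
      by_cases hc : history (fun n => A n ω) m ∈ cont m <;> simp [hH, hc]
    have e2 : ∀ h, φ h * value κ cont g (k + 1) m h
        = (cont m)ᶜ.indicator φ h * g m h
          + ∫⁻ y, (cont m).indicator φ h * value κ cont g k (m + 1) (append h y) ∂κ m h :=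
        fun h => by
      have hv : Measurable fun y => value κ cont g k (m + 1) (append h y) :=
        (measurable_value κ hcont hg k (m + 1)).comp
          ((measurable_append m).comp measurable_prodMk_left)
      rw [lintegral_const_mul _ hv, value]
      by_cases hc : h ∈ cont m <;> simp [hc]
    have hm : Measurable fun ω => (cont m)ᶜ.indicator φ (H ω) * g m (H ω) :=
      (hφ2.comp hh).mul ((hg m).comp hh)
    rw [lintegral_congr e1, lintegral_congr fun ω => e2 (H ω), lintegral_add_left hm,
      lintegral_add_left hm]
    congr 1
    refine (ih (m + 1) (hφ1.comp hmi)).trans ?_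
    exact lintegral_history_succ hA (hκ m)
      (F := fun h h' => (cont m).indicator φ h * value κ cont g k (m + 1) h')
      ((hφ1.comp measurable_fst).mul ((measurable_value κ hcont hg k (m + 1)).comp
        (measurable_append m)))

lemma measure_stopAt_min [IsProbabilityMeasure P] (hA : ∀ n, Measurable (A n))
    (hκ : ∀ m, HasCondDistrib (A m) (fun ω => history (fun n => A n ω) m) (κ m) P)
    (hcont : ∀ m, MeasurableSet (cont m)) {G : Set (ℕ → Y ⊕ Unit)} (hG : MeasurableSet G) (n : ℕ)
    (h₀ : Fin 0 → Y) {s : Set Ω} (hs : MeasurableSet s)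
    (hsG : ∀ ω, ω ∈ s ↔ stopAt (min (exitTime cont fun n => A n ω) n) (fun n => A n ω) ∈ G) :
    P s = value κ cont (fun _ h => G.indicator 1 (pad h)) n 0 h₀ := by
  have hg : ∀ m, Measurable fun h : Fin m → Y => G.indicator (1 : (ℕ → Y ⊕ Unit) → ℝ≥0∞) (pad h) := fun m =>
    (measurable_one.indicator hG).comp (measurable_pad m)
  have key := lintegral_mul_stoppedPayoff hA hκ hcont hg n 0 (φ := fun _ => 1) measurable_const
  simp only [one_mul] at key
  have e1 : ∀ ω, stoppedPayoff cont (fun _ h => G.indicator 1 (pad h)) n 0 (fun n => A n ω)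
      = s.indicator 1 ω := fun ω => by
    rw [stoppedPayoff_pad (G.indicator 1) n 0 _ (by simp), zero_add]
    by_cases h : ω ∈ s
    · rw [Set.indicator_of_mem h, Set.indicator_of_mem ((hsG ω).1 h)]; rfl
    · rw [Set.indicator_of_notMem h, Set.indicator_of_notMem (fun hc => h ((hsG ω).2 hc))]
  simp only [e1, Subsingleton.elim _ h₀] at key
  rw [lintegral_indicator_one hs] at key
  simpa using key

end Stopping

/-! ### From finite horizons to arbitrary events -/

/-- Approximate `G` by a ring element in `μ + ν`. An error `b` costs `b` on the left and `K b` on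
the right, hence the tolerance `η / (1 + K)`. -/
lemma measure_le_of_isSetRing {Z : Type*} {mZ : MeasurableSpace Z} {μ ν : Measure Z}
    [IsFiniteMeasure μ] [IsFiniteMeasure ν] {C : Set (Set Z)} (hC : IsSetRing C)
    (huniv : Set.univ ∈ C) (hgen : mZ = MeasurableSpace.generateFrom C) {K d : ℝ≥0∞}
    (hK : K ≠ ∞) (h : ∀ s ∈ C, μ s ≤ K * ν s + d) {G : Set Z} (hG : MeasurableSet G) :
    μ G ≤ K * ν G + d := by
  refine ENNReal.le_of_forall_pos_le_add fun η hη _ => ?_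
  have hpos : (0 : ℝ≥0∞) < η / (1 + K) :=
    ENNReal.div_pos (by exact_mod_cast hη.ne') (by simp [hK])
  obtain ⟨s, hs, hlt⟩ := exists_measure_symmDiff_lt_of_generateFrom_isSetRing (μ := μ + ν) hC
    ⟨{Set.univ}, Set.countable_singleton _, by simpa using huniv, by simp⟩ hgen hG hpos
  rw [Measure.add_apply] at hlt
  set b := (η : ℝ≥0∞) / (1 + K)
  have h1 : μ G ≤ μ s + b := by
    refine (measure_mono (t := s ∪ s ∆ G) fun x hx => ?_).trans ((measure_union_le _ _).trans ?_)
    · by_cases hxs : x ∈ s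
      · exact Or.inl hxs
      · exact Or.inr (Or.inr ⟨hx, hxs⟩)
    · gcongr; exact le_self_add.trans hlt.le
  have h2 : ν s ≤ ν G + b := by
    refine (measure_mono (t := G ∪ s ∆ G) fun x hx => ?_).trans ((measure_union_le _ _).trans ?_)
    · by_cases hxs : x ∈ G
      · exact Or.inl hxs
      · exact Or.inr (Or.inl ⟨hx, hxs⟩)
    · gcongr; exact le_add_self.trans hlt.le
  calc μ G ≤ (K * (ν G + b) + d) + b := h1.trans (by gcongr; exact (h s hs).trans (by gcongr))
    _ = K * ν G + d + (1 + K) * b := by ring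
    _ = K * ν G + d + η := by
        rw [ENNReal.mul_div_cancel (by simp) (by simp [hK])]

lemma stopAt_min_mem_cylinder_iff {Y : Type*} {I : Finset ℕ} {S : Set (∀ _ : I, Y ⊕ Unit)}
    {n : ℕ} (hn : ∀ i ∈ I, i < n) (N : ℕ∞) (a : ℕ → Y) :
    stopAt (min N n) a ∈ cylinder I S ↔ stopAt N a ∈ cylinder I S := by
  have : I.restrict (stopAt (min N n) a) = I.restrict (stopAt N a) := by
    funext i
    have : ((i : ℕ) : ℕ∞) < n := Nat.cast_lt.2 (hn i i.2)
    simp [stopAt, this]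
  rw [mem_cylinder, mem_cylinder]
  exact Eq.to_iff (congrArg (· ∈ S) this)

/-! ### The stopping threshold and the choice of order -/

section Threshold

/-- The largest sum of squares allowed by the stopping rule. -/
noncomputable def sqBudget (ε l : ℝ) : ℝ := (√(2 * l + 2 * ε) - √(2 * l)) ^ 2

lemma sqBudget_root_pos {ε l : ℝ} (hε : 0 < ε) (hl : 0 ≤ l) :
    0 < √(2 * l + 2 * ε) - √(2 * l) :=
  sub_pos.2 (Real.sqrt_lt_sqrt (by positivity) (by linarith))

/-- Complete the square: the left side says `2l + 2ε < (√S + √(2l))²`. -/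
lemma lt_sqrt_add_iff {ε l S : ℝ} (hε : 0 < ε) (hl : 0 ≤ l) (hS : 0 ≤ S) :
    ε < √(2 * l * S) + 1 / 2 * S ↔ sqBudget ε l < S := by
  have hR := sqBudget_root_pos hε hl
  have h1 := Real.sq_sqrt hS
  have h2 := Real.sq_sqrt (by positivity : 0 ≤ 2 * l)
  have h3 := Real.sq_sqrt (by positivity : 0 ≤ 2 * l + 2 * ε)
  have h4 : (√(2 * l + 2 * ε)) ^ 2 < (√S + √(2 * l)) ^ 2 ↔ √(2 * l + 2 * ε) < √S + √(2 * l) :=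
    pow_lt_pow_iff_left₀ (Real.sqrt_nonneg _) (by positivity) two_ne_zero
  rw [sqBudget, ← Real.lt_sqrt hR.le, sub_lt_iff_lt_add, ← h4, Real.sqrt_mul (by positivity)]
  constructor <;> intro h <;> linarith

/-- With `V = sqBudget ε l`, the quadratic in `t` is minimized at `ε/V - 1/2 = √(2l/V)`, with
minimum `-l`. -/
lemma exp_tail_eq {ε l : ℝ} (hε : 0 < ε) (hl : 0 ≤ l) {t : ℝ}
    (ht : t = √(2 * l) / (√(2 * l + 2 * ε) - √(2 * l))) :
    -(t * ε) + 1 / 2 * t * (t + 1) * sqBudget ε l = -l := by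
  have hR := sqBudget_root_pos hε hl
  have h1 := Real.sq_sqrt (by positivity : 0 ≤ 2 * l)
  have h2 := Real.sq_sqrt (by positivity : 0 ≤ 2 * l + 2 * ε)
  rw [sqBudget]
  set x := √(2 * l)
  set z := √(2 * l + 2 * ε)
  have hx : t * (z - x) = x := by rw [ht]; exact div_mul_cancel₀ _ hR.ne'
  have e : ε = (z ^ 2 - x ^ 2) / 2 := by linarith
  have e' : l = x ^ 2 / 2 := by linarith
  rw [e, e']
  linear_combination (1 / 2 * (t * (z - x)) + 1 / 2 * (z - x) - 1 / 2 * (z + x) + 1 / 2 * x) * hx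

end Threshold

/-- The sum over `n + 1` rounds splits into what is spent before round `n` and the cost of round
`n`, already known from the history. -/
lemma stopRule_eq_exitTime {Y : Type*} {ε δ' δ'' : ℝ} (hε : 0 < ε) (hδ : 0 ≤ Real.log (1 / δ'))
    (εs δs : ∀ n : ℕ, (Fin n → Y) → ℝ≥0) (a : ℕ → Y) :
    stopRule ε δ' δ'' (fun n => εs n (history a n)) (fun n => δs n (history a n))
      = exitTime (budgetSet εs δs (sqBudget ε (Real.log (1 / δ'))) δ'') a := by
  rw [stopRule, exitTime]
  congr 2
  ext n
  have hS : 0 ≤ ∑ m ∈ Finset.range (n + 1), (εs m (history a m) : ℝ) ^ 2 :=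
    Finset.sum_nonneg fun _ _ => sq_nonneg _
  rw [Set.mem_ofPred_eq, Set.mem_ofPred_eq, lt_sqrt_add_iff hε hδ hS, budgetSet,
    Set.mem_ofPred_eq, spent_history, spent_history, ← Finset.sum_range_succ,
    ← Finset.sum_range_succ, not_and_or, not_le, not_le]

/-! ### From the process to iterated kernels, and the final bound -/

section Law

variable {Y : Type*} [MeasurableSpace Y] {Ω : Type*} [MeasurableSpace Ω] {P : Measure Ω}
  [IsProbabilityMeasure P] {A : ℕ → Ω → Y} {κ : ∀ m, Kernel (Fin m → Y) Y}
  [∀ m, IsMarkovKernel (κ m)]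

lemma almostSurelyIn_zero (hA : ∀ n, Measurable (A n))
    (hκ : ∀ m, HasCondDistrib (A m) (fun ω => history (fun n => A n ω) m) (κ m) P)
    {C : ∀ m, Set (Fin m → Y)} (hC : ∀ m, MeasurableSet (C m))
    (h : ∀ m, ∀ᵐ ω ∂P, history (fun n => A n ω) m ∈ C m) (k : ℕ) (h₀ : Fin 0 → Y) :
    AlmostSurelyIn κ C k 0 h₀ := by
  set Q : ∀ m, Measure (Fin m → Y) := fun m => P.map fun ω => history (fun n => A n ω) m with hQ
  have hm := measurable_history hA
  have hQp : ∀ m, IsProbabilityMeasure (Q m) := fun m =>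
    Measure.isProbabilityMeasure_map (hm m).aemeasurable
  have hQs : ∀ m, Q (m + 1) = (Q m ⊗ₘ κ m).map fun z => append z.1 z.2 := fun m => by
    rw [hQ, ← (hκ m).map_eq, Measure.map_map (measurable_append m) ((hm m).prodMk (hA m))]
    simp only [history_succ]
    rfl
  have hQC : ∀ m, ∀ᵐ h ∂Q m, h ∈ C m := fun m =>
    (ae_map_iff (hm m).aemeasurable (hC m)).2 (h m)
  obtain ⟨h₁, hh⟩ := (ae_almostSurelyIn κ hQs hQC k 0).exists
  rwa [Subsingleton.elim h₀ h₁]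

end Law

/-- The privacy guarantee for the process stopped after at most `n` rounds. -/
lemma value_budgetSet_le {Y : Type*} [MeasurableSpace Y] {κ κ' : ∀ m, Kernel (Fin m → Y) Y}
    [∀ m, IsMarkovKernel (κ m)] [∀ m, IsMarkovKernel (κ' m)]
    {εs δs : ∀ m, (Fin m → Y) → ℝ≥0} {g : ∀ m, (Fin m → Y) → ℝ≥0∞}
    (hεs : ∀ m, Measurable (εs m)) (hδs : ∀ m, Measurable (δs m)) (hg : ∀ m, Measurable (g m))
    (hg1 : ∀ m h, g m h ≤ 1) {ε δ l t : ℝ} (hε : 0 < ε) (hl : 0 < l) (hδ : 0 ≤ δ)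
    (ht : t = √(2 * l) / (√(2 * l + 2 * ε) - √(2 * l))) (n : ℕ) (h₀ : Fin 0 → Y)
    (hgood : AlmostSurelyIn κ
      (fun m => {h | RoundCondition (κ m h) (κ' m h) t (εs m h) (δs m h)}) n 0 h₀)
    (hgood' : AlmostSurelyIn κ'
      (fun m => {h | RoundCondition (κ' m h) (κ m h) t (εs m h) (δs m h)}) n 0 h₀) :
    value κ (budgetSet εs δs (sqBudget ε l) δ) g n 0 h₀
      ≤ ENNReal.ofReal (Real.exp ε) * value κ' (budgetSet εs δs (sqBudget ε l) δ) g n 0 h₀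
        + ENNReal.ofReal (Real.exp (-l) + δ) := by
  have ht0 : 0 < t := by
    rw [ht]; exact div_pos (Real.sqrt_pos.2 (by positivity)) (sqBudget_root_pos hε hl.le)
  have h0 : ∀ c : ∀ m, (Fin m → Y) → ℝ, spent c 0 h₀ = 0 := fun c => by simp [spent]
  have key := ratio_mul_value_le (ε := ε) (V := sqBudget ε l) (δ := δ) ht0 hεs hδs hg hg1 n 0 h₀
    (by rw [h0]; exact sq_nonneg _) (by rw [h0]; exact hδ) hgood hgood' 1
  rw [h0, h0, one_mul, one_mul, ENNReal.one_rpow, mul_one, sub_zero, sub_zero,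
    ← ENNReal.ofReal_mul (Real.exp_pos _).le, ← Real.exp_add, exp_tail_eq hε hl.le ht,
    add_assoc, ← ENNReal.ofReal_add hδ (Real.exp_pos _).le, add_comm δ] at key
  exact key

end FullyAdaptive

theorem theorem3 {X : Type*} (nbr : X → X → Prop) (hnbr : ∀ x x', nbr x x' → nbr x' x)
    {Y : Type*} [MeasurableSpace Y] [MeasurableSpace.CountablyGenerated Y]
    -- `A n x` is the output of the `(n + 1)`-st algorithm on the dataset `x`
    {Ω : X → Type*} [∀ x, MeasurableSpace (Ω x)]
    (P : ∀ x, Measure (Ω x)) [∀ x, IsProbabilityMeasure (P x)]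
    (A : ℕ → ∀ x, Ω x → Y) (hA : ∀ n x, Measurable (A n x))
    -- `κ n x h` is the conditional law of `A n x` when the earlier outputs are `h`
    (κ : ∀ n : ℕ, X → Kernel (Fin n → Y) Y) [∀ n x, IsMarkovKernel (κ n x)]
    (hκ : ∀ n x, HasCondDistrib (A n x)
      (fun ω => FullyAdaptive.history (fun m => A m x ω) n) (κ n x) (P x))
    -- the adaptively chosen privacy parameters
    (εs δs : ∀ n : ℕ, (Fin n → Y) → ℝ≥0)
    (hεs : ∀ n, Measurable (εs n)) (hδs : ∀ n, Measurable (δs n))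
    -- in each round, almost surely, one of the two privacy conditions holds given the past
    (hpriv : ∀ x x' : X, nbr x x' → ∀ n : ℕ, ∀ᵐ ω ∂(P x),
      let h := FullyAdaptive.history (fun m => A m x ω) n
      FullyAdaptive.DPBound (κ n x h) (κ n x' h) (εs n h) (δs n h) ∨
      (δs n h = 0 ∧ FullyAdaptive.ZCDPBound (κ n x h) (κ n x' h) (εs n h)))
    (ε δ' δ'' : ℝ) (hε : 0 < ε) (hδ' : 0 < δ') (hδ'' : 0 ≤ δ'') :
    FullyAdaptive.IsDP nbr P
      (fun x ω =>
        let a : ℕ → Y := fun m => A m x ω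
        FullyAdaptive.stopAt
          (FullyAdaptive.stopRule ε δ' δ''
            (fun n => εs n (FullyAdaptive.history a n))
            (fun n => δs n (FullyAdaptive.history a n)))
          a)
      ε (δ' + δ'') := by
  intro x x' hxx' G hG
  -- For `δ' ≥ 1` the bound is trivial; otherwise `log (1/δ') > 0`, as a positive order `t`
  -- requires.
  rcases le_or_gt 1 δ' with h1 | h1
  · refine le_add_left (prob_le_one.trans ?_)
    rw [ENNReal.one_le_ofReal]
    linarith
  set l := Real.log (1 / δ') with hl_def
  have hl : 0 < l := Real.log_pos (one_lt_one_div hδ' h1)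
  have hexp : Real.exp (-l) = δ' := by
    rw [hl_def, one_div, Real.log_inv, neg_neg, Real.exp_log hδ']
  set t := √(2 * l) / (√(2 * l + 2 * ε) - √(2 * l)) with ht
  have ht0 : 0 ≤ t :=
    div_nonneg (Real.sqrt_nonneg _) (FullyAdaptive.sqBudget_root_pos hε hl.le).le
  set B := FullyAdaptive.budgetSet εs δs (FullyAdaptive.sqBudget ε l) δ'' with hB
  have hBm : ∀ m, MeasurableSet (B m) := FullyAdaptive.measurableSet_budgetSet hεs hδs _ _
  have hround : ∀ z z', nbr z z' → ∀ (n : ℕ) (h₀ : Fin 0 → Y),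
      FullyAdaptive.AlmostSurelyIn (fun m => κ m z) (fun m => {h |
        FullyAdaptive.RoundCondition (κ m z h) (κ m z' h) t (εs m h) (δs m h)}) n 0 h₀ := by
    intro z z' hz n h₀
    refine FullyAdaptive.almostSurelyIn_zero (fun m => hA m z) (fun m => hκ m z)
      (fun m => FullyAdaptive.measurableSet_roundCondition (κ m z) (κ m z') (hεs m) (hδs m) t)
      (fun m => ?_) n h₀
    filter_upwards [hpriv z z' hz m] with ω hω
    exact hω.imp id fun h => ⟨h.1, h.2.renyiBound ht0⟩
  set M : ∀ z, Ω z → ℕ → Y ⊕ Unit := fun z ω =>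
    FullyAdaptive.stopAt (FullyAdaptive.exitTime B fun m => A m z ω) fun m => A m z ω with hM
  have hMm : ∀ z, Measurable (M z) := fun z =>
    FullyAdaptive.measurable_stopAt_exitTime (fun m => hA m z) hBm
  have hMeq : ∀ z, M z = fun ω => FullyAdaptive.stopAt (FullyAdaptive.stopRule ε δ' δ''
      (fun n => εs n (FullyAdaptive.history (fun m => A m z ω) n))
      (fun n => δs n (FullyAdaptive.history (fun m => A m z ω) n))) (fun m => A m z ω) := by
    intro z
    funext ω
    rw [FullyAdaptive.stopRule_eq_exitTime hε hl.le]
  simp only [← hMeq]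
  rw [← Measure.map_apply (hMm x) hG, ← Measure.map_apply (hMm x') hG]
  have : IsProbabilityMeasure ((P x).map (M x)) :=
    Measure.isProbabilityMeasure_map (hMm x).aemeasurable
  have : IsProbabilityMeasure ((P x').map (M x')) :=
    Measure.isProbabilityMeasure_map (hMm x').aemeasurable
  -- A cylinder on coordinates below `n` cannot distinguish the process from its truncation after
  -- `n` rounds, so `value` with horizon `n` gives its exact probability.
  refine FullyAdaptive.measure_le_of_isSetRing isSetRing_measurableCylinders
    (univ_mem_measurableCylinders _) generateFrom_measurableCylinders.symm
    ENNReal.ofReal_ne_top (fun s hs => ?_) hG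
  obtain ⟨I, S, hS, rfl⟩ := (mem_measurableCylinders s).1 hs
  have hsm : MeasurableSet (cylinder I S : Set (ℕ → Y ⊕ Unit)) := hS.cylinder I
  obtain ⟨n, hn⟩ : ∃ n, ∀ i ∈ I, i < n :=
    ⟨I.sup id + 1, fun i hi => Nat.lt_succ_of_le (Finset.le_sup (f := id) hi)⟩
  have hval : ∀ z, (P z).map (M z) (cylinder I S) = FullyAdaptive.value (fun m => κ m z) B
      (fun _ h => (cylinder I S).indicator 1 (FullyAdaptive.pad h)) n 0 Fin.elim0 := fun z => by
    rw [Measure.map_apply (hMm z) hsm]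
    exact FullyAdaptive.measure_stopAt_min (fun m => hA m z) (fun m => hκ m z) hBm hsm n _
      (hMm z hsm) fun ω => (FullyAdaptive.stopAt_min_mem_cylinder_iff hn _ _).symm
  rw [hval, hval, ← hexp]
  exact FullyAdaptive.value_budgetSet_le hεs hδs
    (fun m => (measurable_one.indicator hsm).comp (FullyAdaptive.measurable_pad m))
    (fun m h => Set.indicator_le_self' (by simp) _) hε hl hδ'' ht n _
    (hround x x' hxx' n _) (hround x' x (hnbr x x' hxx') n _)
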